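/- **Theorem (asymptotics of the connection probability of macroscopic clusters).** Let $\mathcal S$ be a finite set. Let $\kappa$ and $\kappa_N$ ($N\in\mathbb N$) be symmetric functions $\mathcal S\times\mathcal S\to[0,\infty)$ such that $\kappa_N\to\kappa$ pointwise as $N\to\infty$. For $k\in\mathbb N_0^{\mathcal S}$ write $|k|=\sum_{r}k_r$, and let $(x_1,\dots,x_{|k|})\in\mathcal S^{|k|}$ be any vector that is compatible with $k$, i.e. $\#\{i: x_i=r\}=k_r$ for all $r\in\mathcal S$. Let $p_N(k)$ be the probability that the random graph on $\{1,\dots,|k|\}$ in which every pair $\{i,j\}$ with $i\neq j$ is an edge with probability $1\wedge\frac1N\kappa_N(x_i,x_j)$, independently of all other pairs, is connected (with $p_N(0)=0$). Let $$\tau(k)=\sum_{T}\ \prod_{\{i,j\}\in E(T)}\kappa(x_i,x_j),$$ where the sum is over all spanning trees $T$ on $\{1,\dots,|k|\}$ (with $\tau(0)=0$). Neither quantity depends on the choice of the compatible vector. Fix $y\in[0,1]^{\mathcal S}$, $y\neq0$, write $(\kappa y)_r=\sum_{s\in\mathcal S}\kappa(r,s)y_s$, and let $(k^{(N)})_{N}$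 be a sequence in $\mathbb N_0^{\mathcal S}$ with $\lim_{N\to\infty}k^{(N)}_r/N=y_r$ for all $r\in\mathcal S$. We use the conventions $\log 0=-\infty$ and $0\cdot(-\infty)=0$. 1. It holds that $$\limsup_{N\to\infty}\frac1N\log p_N(k^{(N)})\le\sum_{r\in\mathcal S}y_r\log\bigl(1-e^{-(\kappa y)_r}\bigr),$$ where the right-hand side takes the value $-\infty$ when $y\not\ll\kappa y$, i.e. when $y_r>0=(\kappa y)_r$ for some $r\in\mathcal S$. 2. If in addition $\tau(k^{(N)})>0$ for all but finitely many $N$, and $(k^{(N)}_r)_N$ is bounded in $N$ for every $r$ with $y_r=0$, then $$\lim_{N\to\infty}\frac1N\log p_N(k^{(N)})=\sum_{r\in\mathcal S}y_r\log\bigl(1-e^{-(\kappa y)_r}\bigr)\in[-\infty,0].$$ -/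

import Mathlib

open Filter Topology MeasureTheory

/-- A kernel on the type set `S`: a symmetric function `S × S → [0, ∞)`. -/
structure TypeKernel (S : Type*) where
  /-- The underlying function. -/
  val : S → S → ℝ
  symm : ∀ r s, val r s = val s r
  nonneg : ∀ r s, 0 ≤ val r s

namespace TypeKernel

variable {S : Type*}

/-- The kernel as a function of unordered pairs of types. -/
def onPair (κ : TypeKernel S) : Sym2 S → ℝ :=
  Sym2.lift ⟨κ.val, κ.symm⟩

theorem onPair_nonneg (κ : TypeKernel S) (e : Sym2 S) : 0 ≤ κ.onPair e := by
  induction e using Sym2.ind with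
  | _ r s => exact κ.nonneg r s

/-- The vector `κ y`, that is `(κ y)_r = ∑ s, κ(r, s) y_s`. -/
def mulVec [Fintype S] (κ : TypeKernel S) (y : S → ℝ) (r : S) : ℝ :=
  ∑ s, κ.val r s * y s

/-- The edge probabilities `1 ∧ κ(r, s) / N`, as a function of the unordered pair of types. -/
noncomputable def edgeProb (κ : TypeKernel S) (N : ℕ) (e : Sym2 S) : unitInterval :=
  ⟨min 1 (κ.onPair e / N),
    le_min zero_le_one (div_nonneg (κ.onPair_nonneg e) N.cast_nonneg), min_le_left _ _⟩

open scoped Classical in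
/-- The total weight `∑_T ∏_{{i, j} ∈ E(T)} κ(x_i, x_j)` of all spanning trees `T` of the complete
graph on the vertex set `V`, where vertex `i` has type `x i`. It is zero if `V` is empty, since a
tree has at least one vertex. -/
noncomputable def treeWeight (κ : TypeKernel S) {V : Type*} [Fintype V] (x : V → S) : ℝ :=
  ∑ T : SimpleGraph V with T.IsTree, ∏ e ∈ T.edgeFinset, κ.onPair (e.map x)

end TypeKernel

/-- The law of the inhomogeneous random graph on the vertex set `V` with type vector `x` and edge
probabilities `p`: all possible edges (non-diagonal unordered pairs of vertices) are drawn
independently, the edge `{i, j}` with probability `p {x i, x j}`. -/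
noncomputable def inhomogeneousRandomGraph {S V : Type*} [Fintype V] [DecidableEq V]
    (x : V → S) (p : Sym2 S → unitInterval) : Measure (SimpleGraph V) :=
  (Measure.pi fun e : {e : Sym2 V // ¬ e.IsDiag} =>
      ProbabilityTheory.bernoulliMeasure True False (p (e.1.map x))).map
    fun ω => SimpleGraph.fromEdgeSet {e | ∃ h : ¬ e.IsDiag, ω ⟨e, h⟩}

/-- The probability that the inhomogeneous random graph with type vector `x` and edge
probabilities `1 ∧ κ / N` is connected. It is zero for the empty vertex set, since a connected
graph has at least one vertex. -/
noncomputable def connectionProb {S V : Type*} [Fintype V] [DecidableEq V]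
    (κ : TypeKernel S) (N : ℕ) (x : V → S) : ENNReal :=
  inhomogeneousRandomGraph x (κ.edgeProb N) {G | G.Connected}

/-- The type vector `x` is compatible with the type configuration `k`: exactly `k r` of its
entries are equal to `r`, for every type `r`. -/
def IsCompatible {S V : Type*} (x : V → S) (k : S → ℕ) : Prop :=
  ∀ r, Nat.card {i : V // x i = r} = k r

/-- The extended real number `∑_r y_r log (1 - exp (-(κ y)_r))`, where `log 0 = -∞` and
`0 * (-∞) = 0`. -/
noncomputable def connectionRate {S : Type*} [Fintype S] (κ : TypeKernel S) (y : S → ℝ) : EReal :=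
  ∑ r, (y r : EReal) * ENNReal.log (ENNReal.ofReal (1 - Real.exp (-(κ.mulVec y r))))

/-! For a vertex set `R` let `A_R` be the event that every vertex is connected to `R`. Then `A_V` is
certain and `A_{v}` is connectedness, so the connection probability can be followed while `R`
shrinks from `V` to a single vertex, one vertex at a time.

Fix `v ∈ R` and let `X` be the set of vertices that reach `R \ {v}` without passing through `v`.
Then `A_{R \ {v}}` is `A_R` together with the presence of an edge from `v` to `X`. The set `X`
ignores all edges at `v`, and `A_R` ignores the edges between `v` and `X`. Hence removing `v`
inserts the factor `1 - ∏_{w ∈ X} (1 - p(v, w))` into the expectation (`reachProb.erase_eq`).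

Upper bound: enlarging `X` to `V` gives the factor `hitProb`, which tends to `1 - exp(-(κ y)_r)` for
a vertex of type `r`; about `N y_r` vertices of that type are removed.

Lower bound: on `A_R`, the complements of `X` for different `v ∈ R` are disjoint. By
exchangeability, if `R` contains `m` vertices of the type of `v`, the mean size of the complement is
at most `|V| / m` times the probability of `A_R`, so with edge probabilities `O(1/N)` the factor
drops by only `O(1/m)` (`reachProb.erase_ge`). This works down to a core of bounded size, which
keeps `m` vertices of each type with `y_r ≠ 0` and all vertices of the other types. Positivity of
`τ` ensures that the core can be dismantled along edges of probability at least `c₀ / N`. The cost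
is a power of `N` with bounded exponent, invisible on the exponential scale. Finally `m → ∞`. -/

/-- The expectation of `f` for a random subset of `E` that contains every `e ∈ E` with probability
`p e`, independently of the other elements. -/
noncomputable def bernoulliSum {α : Type*} [DecidableEq α] (E : Finset α) (p : α → ℝ)
    (f : Finset α → ℝ) : ℝ :=
  ∑ s ∈ E.powerset, ((∏ e ∈ s, p e) * ∏ e ∈ E \ s, (1 - p e)) * f s

/-! ### Independence for finite families of Bernoulli variables -/

namespace bernoulliSum

variable {α : Type*} [DecidableEq α] {E : Finset α} {p : α → ℝ} {f g : Finset α → ℝ}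

theorem one : bernoulliSum E p (fun _ => 1) = 1 := by
  simp only [bernoulliSum, mul_one]
  rw [← Finset.prod_add]
  simp

theorem const_mul (c : ℝ) :
    bernoulliSum E p (fun s => c * f s) = c * bernoulliSum E p f := by
  simp only [bernoulliSum, Finset.mul_sum]
  exact Finset.sum_congr rfl fun s _ => by ring

theorem sub : bernoulliSum E p (fun s => f s - g s) = bernoulliSum E p f - bernoulliSum E p g := by
  simp only [bernoulliSum, mul_sub, Finset.sum_sub_distrib]

theorem sum {ι : Type*} (t : Finset ι) (F : ι → Finset α → ℝ) :
    bernoulliSum E p (fun s => ∑ i ∈ t, F i s) = ∑ i ∈ t, bernoulliSum E p (F i) := by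
  simp only [bernoulliSum, Finset.mul_sum]
  exact Finset.sum_comm

theorem congr (h : ∀ s ⊆ E, f s = g s) : bernoulliSum E p f = bernoulliSum E p g :=
  Finset.sum_congr rfl fun s hs => by rw [h s (Finset.mem_powerset.1 hs)]

theorem mono (hp : ∀ e ∈ E, p e ∈ Set.Icc (0 : ℝ) 1) (h : ∀ s ⊆ E, f s ≤ g s) :
    bernoulliSum E p f ≤ bernoulliSum E p g := by
  refine Finset.sum_le_sum fun s hs => ?_
  have hs := Finset.mem_powerset.1 hs
  refine mul_le_mul_of_nonneg_left (h s hs) (mul_nonneg ?_ ?_)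
  · exact Finset.prod_nonneg fun e he => (hp e (hs he)).1
  · exact Finset.prod_nonneg fun e he => sub_nonneg.2 (hp e (Finset.mem_sdiff.1 he).1).2

theorem nonneg (hp : ∀ e ∈ E, p e ∈ Set.Icc (0 : ℝ) 1) (h : ∀ s ⊆ E, 0 ≤ f s) :
    0 ≤ bernoulliSum E p f := by
  have := mono (f := fun _ => 0) hp h
  simpa [bernoulliSum] using this

/-- A single coordinate is independent of every function that does not depend on it. -/
theorem mul_ite_notMem {a : α} (ha : a ∈ E) (h : ∀ s, g (insert a s) = g s) :
    bernoulliSum E p (fun s => g s * if a ∈ s then 0 else 1) = (1 - p a) * bernoulliSum E p g := by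
  obtain ⟨E', ha', rfl⟩ : ∃ E', a ∉ E' ∧ insert a E' = E :=
    ⟨E.erase a, Finset.notMem_erase a E, Finset.insert_erase ha⟩
  simp only [bernoulliSum]
  rw [Finset.sum_powerset_insert ha', Finset.sum_powerset_insert ha', ← Finset.sum_add_distrib,
    ← Finset.sum_add_distrib, Finset.mul_sum]
  refine Finset.sum_congr rfl fun s hs => ?_
  have has : a ∉ s := fun h' => ha' (Finset.mem_powerset.1 hs h')
  have h1 : insert a E' \ s = insert a (E' \ s) := Finset.insert_sdiff_of_notMem _ has
  have h2 : insert a E' \ insert a s = E' \ s := by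
    ext b
    simp only [Finset.mem_sdiff, Finset.mem_insert]
    by_cases hb : b = a
    · simp [hb, ha']
    · simp [hb]
  have h3 : a ∉ E' \ s := fun h' => ha' (Finset.mem_sdiff.1 h').1
  rw [h1, h2, Finset.prod_insert has, Finset.prod_insert h3, h s]
  simp only [has, Finset.mem_insert_self, if_true, if_false]
  ring

/-- The coordinates in `K` are independent of every function that does not depend on them. -/
theorem mul_ite_disjoint {K : Finset α} (hK : K ⊆ E) (h : ∀ a ∈ K, ∀ s, g (insert a s) = g s) :
    bernoulliSum E p (fun s => g s * if Disjoint s K then 1 else 0)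
      = (∏ e ∈ K, (1 - p e)) * bernoulliSum E p g := by
  induction K using Finset.induction_on with
  | empty => simp
  | insert a K ha ih =>
    have ih := ih (fun e he => hK (Finset.mem_insert_of_mem he))
      fun e he => h e (Finset.mem_insert_of_mem he)
    rw [Finset.prod_insert ha, mul_assoc, ← ih,
      ← mul_ite_notMem (hK (Finset.mem_insert_self a K))]
    · refine congr fun s _ => ?_
      by_cases h1 : a ∈ s <;> simp [Finset.disjoint_insert_right, h1]
    · intro s
      rw [h a (Finset.mem_insert_self a K)]
      simp [Finset.disjoint_insert_left, ha]

/-- A version of `mul_ite_disjoint` for a random set `k s` of coordinates, where neither `k` nor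
`g` depend on the coordinates in `k s`. -/
theorem mul_ite_disjoint_random {k : Finset α → Finset α} (hkE : ∀ s, k s ⊆ E)
    (hk : ∀ t, ∀ a ∈ k t, ∀ s, k (insert a s) = k s)
    (hg : ∀ s, ∀ a ∈ k s, g (insert a s) = g s) :
    bernoulliSum E p (fun s => g s * if Disjoint s (k s) then 1 else 0)
      = bernoulliSum E p (fun s => g s * ∏ e ∈ k s, (1 - p e)) := by
  have key : ∀ K ∈ E.powerset,
      bernoulliSum E p (fun s => (g s * if k s = K then 1 else 0) * if Disjoint s K then 1 else 0)
        = (∏ e ∈ K, (1 - p e)) * bernoulliSum E p (fun s => g s * if k s = K then 1 else 0) := by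
    intro K hKE
    -- If `K` is a value of `k`, then `hk` makes the event `k s = K` insensitive to the coordinates
    -- in `K`; otherwise both sides vanish.
    by_cases hex : ∃ t, k t = K
    · obtain ⟨t, ht⟩ := hex
      refine mul_ite_disjoint (Finset.mem_powerset.1 hKE) fun a ha s => ?_
      rw [hk t a (ht ▸ ha)]
      split_ifs with hs
      · rw [hg s a (hs ▸ ha)]
      · simp
    · have : ∀ s, k s ≠ K := fun s hs => hex ⟨s, hs⟩
      simp [this, bernoulliSum]
  calc _ = ∑ K ∈ E.powerset, bernoulliSum E p
        (fun s => (g s * if k s = K then 1 else 0) * if Disjoint s K then 1 else 0) := by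
        rw [← sum]
        refine congr fun s _ => ?_
        rw [Finset.sum_eq_single (k s)]
        · simp
        · intro K _ hK
          simp [hK.symm]
        · intro h'
          exact absurd (Finset.mem_powerset.2 (hkE s)) h'
    _ = ∑ K ∈ E.powerset, bernoulliSum E p
        (fun s => (∏ e ∈ K, (1 - p e)) * (g s * if k s = K then 1 else 0)) := by
        refine Finset.sum_congr rfl fun K hK => ?_
        rw [key K hK, const_mul]
    _ = _ := by
        rw [← sum]
        refine congr fun s _ => ?_
        rw [Finset.sum_eq_single (k s)]
        · simp [mul_comm]
        · intro K _ hK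
          simp [hK.symm]
        · intro h'
          exact absurd (Finset.mem_powerset.2 (hkE s)) h'

/-- Invariance under a permutation of the coordinates that preserves the probabilities. -/
theorem comp_map (σ : α ≃ α) (hE : E.map σ.toEmbedding = E) (hp : ∀ e, p (σ e) = p e) :
    bernoulliSum E p (fun s => f (s.map σ.toEmbedding)) = bernoulliSum E p f := by
  refine Finset.sum_equiv σ.finsetCongr (fun s => ?_) fun s hs => ?_
  · rw [Equiv.finsetCongr_apply, Finset.mem_powerset, Finset.mem_powerset, ← hE,
      Finset.map_subset_map, hE]
  · rw [Equiv.finsetCongr_apply]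
    have : E \ s.map σ.toEmbedding = (E \ s).map σ.toEmbedding := by
      conv_lhs => rw [← hE]
      rw [Finset.map_sdiff]
    rw [this, Finset.prod_map, Finset.prod_map]
    simp [hp]

end bernoulliSum

/-! ### The random graph as a random set of pairs -/

/-- The possible edges of a graph on `V`. -/
def vertexPairs (V : Type*) [Fintype V] [DecidableEq V] : Finset (Sym2 V) :=
  Finset.univ.filter fun e => ¬ e.IsDiag

theorem mem_vertexPairs {V : Type*} [Fintype V] [DecidableEq V] {a b : V} :
    s(a, b) ∈ vertexPairs V ↔ a ≠ b := by
  simp [vertexPairs]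

-- Passes from measures to finite sums, so that all independence arguments become algebra with
-- `bernoulliSum`.
open scoped Classical in
theorem inhomogeneousRandomGraph_apply {S V : Type*} [Fintype V] [DecidableEq V]
    (x : V → S) (p : Sym2 S → unitInterval) (A : Set (SimpleGraph V)) :
    inhomogeneousRandomGraph x p A = ENNReal.ofReal (bernoulliSum (vertexPairs V)
      (fun e => (p (e.map x) : ℝ))
      (fun s => if SimpleGraph.fromEdgeSet (s : Set (Sym2 V)) ∈ A then 1 else 0)) := by
  have hA : MeasurableSet A := by
    have hs : ∀ G : SimpleGraph V, MeasurableSet ({G} : Set (SimpleGraph V)) := fun G => by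
      -- The σ-algebra on graphs is pulled back along the injective map `Adj`.
      refine ⟨{G.Adj}, measurableSet_singleton _, ?_⟩
      ext H
      exact SimpleGraph.adj_inj
    rw [← Set.biUnion_of_singleton A]
    exact Set.Finite.measurableSet_biUnion A.toFinite fun G _ => hs G
  have hmeas : Measurable fun ω : {e : Sym2 V // ¬ e.IsDiag} → Prop =>
      SimpleGraph.fromEdgeSet {e : Sym2 V | ∃ h : ¬ e.IsDiag, ω ⟨e, h⟩} :=
    measurable_of_countable _
  rw [inhomogeneousRandomGraph, Measure.map_apply hmeas hA]
  set μ := Measure.pi fun e : {e : Sym2 V // ¬ e.IsDiag} =>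
    ProbabilityTheory.bernoulliMeasure True False (p (e.1.map x)) with hμ
  set B := (fun ω : {e : Sym2 V // ¬ e.IsDiag} → Prop =>
      SimpleGraph.fromEdgeSet {e : Sym2 V | ∃ h : ¬ e.IsDiag, ω ⟨e, h⟩}) ⁻¹' A with hB
  have h1 : μ B = ∑ ω : {e : Sym2 V // ¬ e.IsDiag} → Prop, if ω ∈ B then μ {ω} else 0 := by
    rw [← Finset.sum_filter, sum_measure_singleton]
    simp
  have h2 : ∀ ω : {e : Sym2 V // ¬ e.IsDiag} → Prop, μ {ω} = ENNReal.ofReal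
      (∏ e : {e : Sym2 V // ¬ e.IsDiag},
        if ω e then (p (e.1.map x) : ℝ) else 1 - (p (e.1.map x) : ℝ)) := by
    intro ω
    rw [hμ, Measure.pi_singleton, ENNReal.ofReal_prod_of_nonneg]
    · refine Finset.prod_congr rfl fun e _ => ?_
      rw [ProbabilityTheory.bernoulliMeasure_apply _ (measurableSet_singleton _)]
      by_cases h : ω e
      · simp [h, unitInterval.toNNReal, ENNReal.ofReal, Real.toNNReal_of_nonneg (p (e.1.map x)).2.1]
        rfl
      · simp [h, unitInterval.toNNReal, ENNReal.ofReal,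
          Real.toNNReal_of_nonneg (unitInterval.one_minus_nonneg (p (e.1.map x)))]
        rfl
    · intro e _
      split_ifs
      · exact (p _).2.1
      · exact unitInterval.one_minus_nonneg _
  have h3 : ∀ ω : {e : Sym2 V // ¬ e.IsDiag} → Prop,
      0 ≤ ∏ e : {e : Sym2 V // ¬ e.IsDiag},
        if ω e then (p (e.1.map x) : ℝ) else 1 - (p (e.1.map x) : ℝ) := fun ω =>
    Finset.prod_nonneg fun e _ => by
      split_ifs
      · exact (p _).2.1
      · exact unitInterval.one_minus_nonneg _
  rw [h1]
  have h4 : ∀ ω, (if ω ∈ B then μ {ω} else 0) = ENNReal.ofReal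
      ((∏ e : {e : Sym2 V // ¬ e.IsDiag},
        if ω e then (p (e.1.map x) : ℝ) else 1 - (p (e.1.map x) : ℝ)) *
        if ω ∈ B then 1 else 0) := by
    intro ω
    split_ifs <;> simp [h2]
  simp_rw [h4]
  rw [← ENNReal.ofReal_sum_of_nonneg]
  swap
  · intro ω _
    refine mul_nonneg (h3 ω) ?_
    split_ifs <;> simp
  congr 1
  rw [bernoulliSum]
  refine Finset.sum_bij' (fun ω _ => (vertexPairs V).filter fun e => ∃ h : ¬ e.IsDiag, ω ⟨e, h⟩)
    (fun s _ e => e.1 ∈ s) ?_ ?_ ?_ ?_ ?_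
  · intro ω _
    exact Finset.mem_powerset.2 (Finset.filter_subset _ _)
  · simp
  · intro ω _
    ext ⟨e, he⟩
    simp [vertexPairs, he]
  · intro s hs
    ext e
    have := @Finset.mem_powerset _ s (vertexPairs V)
    simp only [vertexPairs, Finset.mem_filter, Finset.mem_univ, true_and]
    constructor
    · rintro ⟨_, _, h⟩
      exact h
    · intro h
      have h' := this.1 hs h
      simp only [vertexPairs, Finset.mem_filter, Finset.mem_univ, true_and] at h'
      exact ⟨h', h', h⟩
  · intro ω _
    congr 1
    · have : ∀ e : {e : Sym2 V // ¬ e.IsDiag}, (ω e ↔ ∃ h : ¬ e.1.IsDiag, ω ⟨e.1, h⟩) :=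
        fun e => ⟨fun h => ⟨e.2, h⟩, fun ⟨_, h⟩ => h⟩
      rw [Finset.prod_congr rfl fun e _ => if_congr (this e) rfl rfl,
        ← Finset.prod_subtype (vertexPairs V) (p := fun e : Sym2 V => ¬ e.IsDiag)
        (fun e => Finset.mem_filter.trans (and_iff_right (Finset.mem_univ e)))
        (fun e => if ∃ h : ¬ e.IsDiag, ω ⟨e, h⟩ then (p (e.map x) : ℝ)
          else 1 - (p (e.map x) : ℝ)), Finset.prod_ite, Finset.filter_not]
    · congr 1
      rw [hB, Set.mem_preimage]
      congr! 3
      ext e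
      simp only [vertexPairs, Set.mem_ofPred_eq, Finset.coe_filter, Finset.mem_filter,
        Finset.mem_univ, true_and]
      exact ⟨fun h => ⟨h.1, h⟩, fun h => h.2⟩

/-! ### Connections to a vertex set, with and without the help of one vertex -/

namespace SimpleGraph

variable {V : Type*} {G H : SimpleGraph V} {R : Finset V} {u v a b z : V}

/-- Every vertex is connected to some vertex of `R`. -/
def ReachesSet (G : SimpleGraph V) (R : Finset V) : Prop :=
  ∀ a, ∃ r ∈ R, G.Reachable a r

/-- The vertex `a ≠ v` is connected to `R \ {v}` by a path that avoids `v`. -/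
def ReachesAvoiding (G : SimpleGraph V) (R : Finset V) (v a : V) : Prop :=
  a ≠ v ∧ ∃ r ∈ R, r ≠ v ∧ (G.deleteIncidenceSet v).Reachable a r

theorem reachesSet_singleton [Nonempty V] : G.ReachesSet {v} ↔ G.Connected := by
  simp only [ReachesSet, Finset.mem_singleton, exists_eq_left]
  exact ⟨fun h => ⟨fun a b => (h a).trans (h b).symm⟩, fun h a => h.preconnected a v⟩

theorem reachesSet_univ [Fintype V] : G.ReachesSet Finset.univ :=
  fun a => ⟨a, Finset.mem_univ a, Reachable.refl a⟩

/-- Follow a walk from `a` until just before its first visit to `v`, if there is one. -/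
theorem Reachable.avoiding (h : G.Reachable a z) (ha : a ≠ v) :
    (z ≠ v ∧ (G.deleteIncidenceSet v).Reachable a z) ∨
      ∃ w, G.Adj v w ∧ (G.deleteIncidenceSet v).Reachable a w := by
  obtain ⟨p⟩ := h
  induction p with
  | nil => exact Or.inl ⟨ha, Reachable.refl _⟩
  | @cons a b z hab p ih =>
    by_cases hb : b = v
    · subst hb
      exact Or.inr ⟨a, hab.symm, Reachable.refl _⟩
    · have hab' : (G.deleteIncidenceSet v).Reachable a b :=
        (deleteIncidenceSet_adj.2 ⟨hab, ha, hb⟩ : (G.deleteIncidenceSet v).Adj a b).reachable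
      rcases ih hb with ⟨h1, h2⟩ | ⟨w, h1, h2⟩
      · exact Or.inl ⟨h1, hab'.trans h2⟩
      · exact Or.inr ⟨w, h1, hab'.trans h2⟩

theorem Reachable.of_deleteIncidenceSet (h : (G.deleteIncidenceSet v).Reachable a z) :
    G.Reachable a z :=
  h.mono (deleteIncidenceSet_le G v)

theorem ReachesAvoiding.of_reachable (h : G.ReachesAvoiding R v b) (ha : a ≠ v)
    (hab : (G.deleteIncidenceSet v).Reachable a b) : G.ReachesAvoiding R v a :=
  ⟨ha, h.2.imp fun _ hr => ⟨hr.1, hr.2.1, hab.trans hr.2.2⟩⟩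

theorem reachesAvoiding_congr (h : G.deleteIncidenceSet v = H.deleteIncidenceSet v) :
    G.ReachesAvoiding R v a ↔ H.ReachesAvoiding R v a := by
  rw [ReachesAvoiding, ReachesAvoiding, h]

theorem reachesAvoiding_of_mem (ha : a ∈ R) (hav : a ≠ v) : G.ReachesAvoiding R v a :=
  ⟨hav, a, ha, hav, Reachable.refl a⟩

/-- Once `v` has an edge to a vertex that reaches `R \ {v}` by itself, everything that relied on `v`
is served too. Conversely, a path from `v` to `R \ {v}` supplies such an edge after its last visit
to `v`. -/
theorem reachesSet_erase_iff [DecidableEq V] (hv : v ∈ R) :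
    G.ReachesSet (R.erase v) ↔ G.ReachesSet R ∧ ∃ w, G.ReachesAvoiding R v w ∧ G.Adj v w := by
  constructor
  · intro h
    refine ⟨fun a => (h a).imp fun r hr => ⟨Finset.mem_of_mem_erase hr.1, hr.2⟩, ?_⟩
    obtain ⟨z, hz, hvz⟩ := h v
    rw [Finset.mem_erase] at hz
    rcases hvz.symm.avoiding hz.1 with ⟨h1, _⟩ | ⟨w, h1, h2⟩
    · exact absurd rfl h1
    · exact ⟨w, ⟨h1.ne', z, hz.2, hz.1, h2.symm⟩, h1⟩
  · rintro ⟨h, w, ⟨_, z, hz, hzv, hwz⟩, hvw⟩ a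
    obtain ⟨r, hr, har⟩ := h a
    by_cases hrv : r = v
    · subst hrv
      exact ⟨z, Finset.mem_erase.2 ⟨hzv, hz⟩,
        har.trans (hvw.reachable.trans hwz.of_deleteIncidenceSet)⟩
    · exact ⟨r, Finset.mem_erase.2 ⟨hrv, hr⟩, har⟩

/-- The point of this form is that the only edges at `v` it mentions lead to vertices that do not
reach `R \ {v}` without `v`. -/
theorem reachesSet_iff_of_mem (hv : v ∈ R) :
    G.ReachesSet R ↔ ∀ a, a ≠ v → G.ReachesAvoiding R v a ∨
      ∃ w, ¬ G.ReachesAvoiding R v w ∧ G.Adj v w ∧ (G.deleteIncidenceSet v).Reachable a w := by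
  constructor
  · intro h a ha
    by_cases hX : G.ReachesAvoiding R v a
    · exact Or.inl hX
    · obtain ⟨r, hr, har⟩ := h a
      rcases har.avoiding ha with ⟨h1, h2⟩ | ⟨w, h1, h2⟩
      · exact Or.inl ⟨ha, r, hr, h1, h2⟩
      · exact Or.inr ⟨w, fun hw => hX (hw.of_reachable ha h2), h1, h2⟩
  · intro h a
    by_cases ha : a = v
    · exact ⟨v, hv, ha ▸ Reachable.refl _⟩
    · rcases h a ha with ⟨_, r, hr, _, har⟩ | ⟨w, _, hvw, haw⟩
      · exact ⟨r, hr, har.of_deleteIncidenceSet⟩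
      · exact ⟨v, hv, haw.of_deleteIncidenceSet.trans hvw.symm.reachable⟩

/-- Whether every vertex is connected to `R` does not depend on the edges between `v ∈ R` and the
vertices that are connected to `R \ {v}` without the help of `v`. -/
theorem reachesSet_congr (hv : v ∈ R) (h : G.deleteIncidenceSet v = H.deleteIncidenceSet v)
    (h' : ∀ w, ¬ G.ReachesAvoiding R v w → (G.Adj v w ↔ H.Adj v w)) :
    G.ReachesSet R ↔ H.ReachesSet R := by
  rw [reachesSet_iff_of_mem hv, reachesSet_iff_of_mem hv, ← h]
  refine forall₂_congr fun a _ => or_congr (reachesAvoiding_congr h) (exists_congr fun w => ?_)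
  rw [← reachesAvoiding_congr h]
  exact and_congr_right fun hw => and_congr_left fun _ => h' w hw

/-- The vertex sets that are cut off from the rest of `R` by a single vertex of `R` are disjoint. -/
theorem ReachesSet.exists_reachesAvoiding (h : G.ReachesSet R) (a : V) :
    ∃ u₀ ∈ R, ∀ u ∈ R, u ≠ u₀ → G.ReachesAvoiding R u a := by
  -- The witness `u₀` is the first vertex of `R` on a walk from `a` into `R`: up to there, the walk
  -- avoids every other vertex of `R`.
  obtain ⟨z, hz, ⟨p⟩⟩ := h a
  clear h
  induction p with
  | @nil a => exact ⟨a, hz, fun u _ hu => reachesAvoiding_of_mem hz hu.symm⟩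
  | @cons a b z hab p ih =>
    by_cases ha : a ∈ R
    · exact ⟨a, ha, fun u _ hu => reachesAvoiding_of_mem ha hu.symm⟩
    · obtain ⟨u₀, hu₀, hu⟩ := ih hz
      refine ⟨u₀, hu₀, fun u huR hne => ?_⟩
      have hb := hu u huR hne
      have hau : a ≠ u := fun h => ha (h ▸ huR)
      exact hb.of_reachable hau
        (deleteIncidenceSet_adj.2 ⟨hab, hau, hb.1⟩ : (G.deleteIncidenceSet u).Adj a b).reachable

theorem deleteIncidenceSet_fromEdgeSet_insert {s : Set (Sym2 V)} :
    (fromEdgeSet (insert s(v, a) s)).deleteIncidenceSet v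
      = (fromEdgeSet s).deleteIncidenceSet v := by
  ext c d
  simp only [deleteIncidenceSet_adj, fromEdgeSet_adj, Set.mem_insert_iff, Sym2.eq_iff]
  constructor
  · rintro ⟨⟨(⟨rfl, rfl⟩ | ⟨rfl, rfl⟩) | h, hne⟩, h1, h2⟩
    · exact absurd rfl h1
    · exact absurd rfl h2
    · exact ⟨⟨h, hne⟩, h1, h2⟩
  · rintro ⟨⟨h, hne⟩, h1, h2⟩
    exact ⟨⟨Or.inr h, hne⟩, h1, h2⟩

theorem reachesSet_map_iff (σ : V ≃ V) (hR : R.map σ.toEmbedding = R) :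
    (G.map σ.toEmbedding).ReachesSet R ↔ G.ReachesSet R := by
  have key : ∀ a b, (G.map σ.toEmbedding).Reachable (σ a) (σ b) ↔ G.Reachable a b :=
    fun a b => (Iso.map σ G).reachable_iff
  constructor
  · intro h a
    obtain ⟨r, hr, har⟩ := h (σ a)
    rw [← hR] at hr
    obtain ⟨r, hr', rfl⟩ := Finset.mem_map.1 hr
    exact ⟨r, hr', (key a r).1 har⟩
  · intro h a
    obtain ⟨r, hr, har⟩ := h (σ.symm a)
    refine ⟨σ r, hR ▸ Finset.mem_map_of_mem σ.toEmbedding hr, ?_⟩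
    have := (key _ _).2 har
    rwa [σ.apply_symm_apply] at this

theorem reachesAvoiding_map_iff (σ : V ≃ V) (hR : R.map σ.toEmbedding = R) :
    (G.map σ.toEmbedding).ReachesAvoiding R (σ v) (σ a) ↔ G.ReachesAvoiding R v a := by
  have hdel : (G.map σ.toEmbedding).deleteIncidenceSet (σ v)
      = (G.deleteIncidenceSet v).map σ.toEmbedding := by
    ext c d
    obtain ⟨c, rfl⟩ := σ.surjective c
    obtain ⟨d, rfl⟩ := σ.surjective d
    have h1 : ∀ K : SimpleGraph V, (K.map σ.toEmbedding).Adj (σ c) (σ d) ↔ K.Adj c d :=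
      fun K => map_adj_apply (f := σ.toEmbedding)
    rw [deleteIncidenceSet_adj, h1, h1, deleteIncidenceSet_adj, σ.injective.ne_iff,
      σ.injective.ne_iff]
  have key : ∀ a b, ((G.deleteIncidenceSet v).map σ.toEmbedding).Reachable (σ a) (σ b) ↔
      (G.deleteIncidenceSet v).Reachable a b :=
    fun a b => (Iso.map σ _).reachable_iff
  rw [ReachesAvoiding, ReachesAvoiding, hdel, σ.injective.ne_iff]
  refine and_congr_right fun _ => ⟨?_, ?_⟩
  · rintro ⟨r, hr, hrv, har⟩
    rw [← hR] at hr
    obtain ⟨r, hr', rfl⟩ := Finset.mem_map.1 hr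
    exact ⟨r, hr', fun h => hrv (congrArg σ h), (key a r).1 har⟩
  · rintro ⟨r, hr, hrv, har⟩
    exact ⟨σ r, hR ▸ Finset.mem_map_of_mem σ.toEmbedding hr, σ.injective.ne hrv, (key a r).2 har⟩

theorem fromEdgeSet_map (σ : V ≃ V) (s : Set (Sym2 V)) :
    fromEdgeSet (Sym2.map σ '' s) = (fromEdgeSet s).map σ.toEmbedding := by
  ext c d
  obtain ⟨c, rfl⟩ := σ.surjective c
  obtain ⟨d, rfl⟩ := σ.surjective d
  have h1 : ((fromEdgeSet s).map σ.toEmbedding).Adj (σ c) (σ d) ↔ (fromEdgeSet s).Adj c d :=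
    map_adj_apply (f := σ.toEmbedding)
  have h2 : s(σ c, σ d) = Sym2.map σ s(c, d) := rfl
  rw [h1, fromEdgeSet_adj, fromEdgeSet_adj, h2,
    (Sym2.map.injective σ.injective).mem_set_image, σ.injective.ne_iff]

end SimpleGraph

/-! ### The cost of removing one vertex from the target set -/

open scoped Classical in
/-- The probability that every vertex of the inhomogeneous random graph with type vector `x` and
edge probabilities `p` is connected to some vertex of `R`. -/
noncomputable def reachProb {S V : Type*} [Fintype V] [DecidableEq V] (x : V → S)
    (p : Sym2 S → unitInterval) (R : Finset V) : ℝ :=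
  bernoulliSum (vertexPairs V) (fun e => (p (e.map x) : ℝ))
    fun s => if (SimpleGraph.fromEdgeSet (s : Set (Sym2 V))).ReachesSet R then 1 else 0

/-- The permutation of the unordered pairs that is induced by a permutation. -/
def Sym2.mapEquiv {V : Type*} (σ : V ≃ V) : Sym2 V ≃ Sym2 V where
  toFun := Sym2.map σ
  invFun := Sym2.map σ.symm
  left_inv e := by simp [Sym2.map_map]
  right_inv e := by simp [Sym2.map_map]

namespace reachProb

variable {S V : Type*} {x : V → S} {p : Sym2 S → unitInterval} {R : Finset V} {v : V}

theorem edgeProb_mem (e : Sym2 V) : (p (e.map x) : ℝ) ∈ Set.Icc (0 : ℝ) 1 := (p _).2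

theorem one_sub_mem (r s : S) : 1 - (p s(r, s) : ℝ) ∈ Set.Icc (0 : ℝ) 1 :=
  ⟨sub_nonneg.2 (p _).2.2, sub_le_self _ (p _).2.1⟩

theorem prod_one_sub_le_one (W : Finset V) (r : S) : ∏ w ∈ W, (1 - (p s(r, x w) : ℝ)) ≤ 1 :=
  Finset.prod_le_one (fun _ _ => (one_sub_mem _ _).1) fun _ _ => (one_sub_mem _ _).2

theorem prod_one_sub_nonneg (W : Finset V) (r : S) : 0 ≤ ∏ w ∈ W, (1 - (p s(r, x w) : ℝ)) :=
  Finset.prod_nonneg fun _ _ => (one_sub_mem _ _).1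

theorem prod_one_sub_anti [DecidableEq V] {W W' : Finset V} (h : W ⊆ W') (r : S) :
    ∏ w ∈ W', (1 - (p s(r, x w) : ℝ)) ≤ ∏ w ∈ W, (1 - (p s(r, x w) : ℝ)) := by
  rw [← Finset.prod_sdiff h]
  exact mul_le_of_le_one_left (prod_one_sub_nonneg _ _) (prod_one_sub_le_one _ _)

theorem one_sub_prod_le_sum [DecidableEq V] (W : Finset V) (r : S) :
    1 - ∏ w ∈ W, (1 - (p s(r, x w) : ℝ)) ≤ ∑ w ∈ W, (p s(r, x w) : ℝ) := by
  induction W using Finset.induction_on with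
  | empty => simp
  | insert a W ha ih =>
    rw [Finset.prod_insert ha, Finset.sum_insert ha]
    nlinarith [prod_one_sub_le_one (p := p) (x := x) W r, (p s(r, x a)).2.1]

theorem map_swap_eq [DecidableEq V] {u : V} (hu : u ∈ R) (hv : v ∈ R) :
    R.map (Equiv.swap u v).toEmbedding = R := by
  refine Finset.eq_of_subset_of_card_le (fun a ha => ?_) (Finset.card_map _).ge
  obtain ⟨b, hb, rfl⟩ := Finset.mem_map.1 ha
  simp only [Equiv.coe_toEmbedding, Equiv.swap_apply_def]
  split_ifs <;> assumption

open scoped Classical in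
/-- The vertices that are connected to `R \ {v}` by a path that avoids `v`. -/
noncomputable def avoidingSet [Fintype V] (R : Finset V) (v : V) (s : Finset (Sym2 V)) : Finset V :=
  Finset.univ.filter fun a => (SimpleGraph.fromEdgeSet (s : Set (Sym2 V))).ReachesAvoiding R v a

theorem mem_avoidingSet [Fintype V] {s : Finset (Sym2 V)} {a : V} : a ∈ avoidingSet R v s ↔
    (SimpleGraph.fromEdgeSet (s : Set (Sym2 V))).ReachesAvoiding R v a := by
  simp [avoidingSet]

variable [Fintype V] [DecidableEq V]

theorem singleton_eq (v : V) : inhomogeneousRandomGraph x p {G | G.Connected}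
    = ENNReal.ofReal (reachProb x p {v}) := by
  classical
  rw [inhomogeneousRandomGraph_apply, reachProb]
  have : Nonempty V := ⟨v⟩
  refine congrArg _ (bernoulliSum.congr fun s _ => ?_)
  by_cases h : (SimpleGraph.fromEdgeSet (s : Set (Sym2 V))).Connected
  · rw [if_pos (SimpleGraph.reachesSet_singleton.2 h)]
    exact if_pos h
  · rw [if_neg (mt SimpleGraph.reachesSet_singleton.1 h)]
    exact if_neg h

theorem univ_eq : reachProb x p Finset.univ = 1 := by
  simp only [reachProb, SimpleGraph.reachesSet_univ, if_true]
  exact bernoulliSum.one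

theorem nonneg : 0 ≤ reachProb x p R := by
  classical
  refine bernoulliSum.nonneg (fun e _ => edgeProb_mem e) fun s _ => ?_
  split_ifs <;> simp

theorem avoidingSet_insert (s : Finset (Sym2 V)) (a : V) :
    avoidingSet R v (insert s(v, a) s) = avoidingSet R v s := by
  ext b
  rw [mem_avoidingSet, mem_avoidingSet]
  refine SimpleGraph.reachesAvoiding_congr ?_
  rw [Finset.coe_insert, SimpleGraph.deleteIncidenceSet_fromEdgeSet_insert]

open scoped Classical in
/-- The probability of a connection to `R \ {v}`, in terms of that of a connection to `R`. -/
theorem erase_eq (hv : v ∈ R) : reachProb x p (R.erase v) =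
    bernoulliSum (vertexPairs V) (fun e => (p (e.map x) : ℝ)) fun s =>
      (if (SimpleGraph.fromEdgeSet (s : Set (Sym2 V))).ReachesSet R then 1 else 0) *
        (1 - ∏ w ∈ avoidingSet R v s, (1 - (p s(x v, x w) : ℝ))) := by
  have himg : ∀ s, ∀ e, e ∈ (avoidingSet R v s).image (fun w => s(v, w)) ↔
      ∃ w, w ∈ avoidingSet R v s ∧ s(v, w) = e := fun s e => Finset.mem_image
  -- The random coordinates are the pairs between `v` and `avoidingSet R v s`; disjointness from
  -- them means that `v` has no edge into that set.
  have h := bernoulliSum.mul_ite_disjoint_random (E := vertexPairs V)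
    (p := fun e => (p (e.map x) : ℝ))
    (k := fun s => (avoidingSet R v s).image fun w => s(v, w))
    (g := fun s => if (SimpleGraph.fromEdgeSet (s : Set (Sym2 V))).ReachesSet R then 1 else 0)
    ?_ ?_ ?_
  · have hprod : ∀ s : Finset (Sym2 V), ∏ e ∈ (avoidingSet R v s).image (fun w => s(v, w)),
        (1 - (p (e.map x) : ℝ)) = ∏ w ∈ avoidingSet R v s, (1 - (p s(x v, x w) : ℝ)) := by
      intro s
      rw [Finset.prod_image fun a _ b _ hab => Sym2.congr_right.1 hab]
      rfl
    simp only [hprod] at h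
    have hsub := bernoulliSum.sub (E := vertexPairs V) (p := fun e => (p (e.map x) : ℝ))
      (f := fun s => if (SimpleGraph.fromEdgeSet (s : Set (Sym2 V))).ReachesSet R then 1 else 0)
      (g := fun s => (if (SimpleGraph.fromEdgeSet (s : Set (Sym2 V))).ReachesSet R
        then 1 else 0) * ∏ w ∈ avoidingSet R v s, (1 - (p s(x v, x w) : ℝ)))
    simp only [mul_sub, mul_one]
    rw [hsub, ← h, ← bernoulliSum.sub, reachProb]
    refine bernoulliSum.congr fun s hs => ?_
    have hiff := SimpleGraph.reachesSet_erase_iff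
      (G := SimpleGraph.fromEdgeSet (s : Set (Sym2 V))) hv
    have hdisj : Disjoint s ((avoidingSet R v s).image fun w => s(v, w)) ↔
        ¬ ∃ w, (SimpleGraph.fromEdgeSet (s : Set (Sym2 V))).ReachesAvoiding R v w ∧
          (SimpleGraph.fromEdgeSet (s : Set (Sym2 V))).Adj v w := by
      rw [Finset.disjoint_right]
      constructor
      · rintro h1 ⟨w, hw, hvw⟩
        exact h1 ((himg s _).2 ⟨w, mem_avoidingSet.2 hw, rfl⟩)
          (SimpleGraph.fromEdgeSet_adj _ |>.1 hvw).1
      · intro h1 e he hes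
        obtain ⟨w, hw, rfl⟩ := (himg s e).1 he
        have hw := mem_avoidingSet.1 hw
        exact h1 ⟨w, hw, (SimpleGraph.fromEdgeSet_adj _).2 ⟨hes, hw.1.symm⟩⟩
    simp only [hdisj, hiff]
    by_cases h1 : (SimpleGraph.fromEdgeSet (s : Set (Sym2 V))).ReachesSet R
    · by_cases h2 : ∃ w, (SimpleGraph.fromEdgeSet (s : Set (Sym2 V))).ReachesAvoiding R v w ∧
          (SimpleGraph.fromEdgeSet (s : Set (Sym2 V))).Adj v w
      · simp only [h1, h2]; simp
      · simp only [h1, h2]; simp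
    · simp only [h1]; simp
  · intro s e he
    obtain ⟨w, hw, rfl⟩ := (himg s e).1 he
    exact mem_vertexPairs.2 (mem_avoidingSet.1 hw).1.symm
  · intro t e he s
    obtain ⟨w, hw, rfl⟩ := (himg t e).1 he
    simp only [avoidingSet_insert]
  · intro s e he
    obtain ⟨w, hw, rfl⟩ := (himg s e).1 he
    have : (SimpleGraph.fromEdgeSet ((insert s(v, w) s : Finset (Sym2 V)) :
        Set (Sym2 V))).ReachesSet R ↔
        (SimpleGraph.fromEdgeSet (s : Set (Sym2 V))).ReachesSet R := by
      refine (SimpleGraph.reachesSet_congr hv ?_ fun b hb => ?_).symm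
      · rw [Finset.coe_insert, SimpleGraph.deleteIncidenceSet_fromEdgeSet_insert]
      · have hbw : b ≠ w := fun h => hb (h ▸ mem_avoidingSet.1 hw)
        simp only [SimpleGraph.fromEdgeSet_adj, Finset.coe_insert, Set.mem_insert_iff,
          Sym2.congr_right, hbw, false_or]
    simp only [this]

/-- The avoiding set is enlarged to all of `V`. The product even contains the loop factor `w = v`,
which only weakens the bound. -/
theorem erase_le (hv : v ∈ R) : reachProb x p (R.erase v) ≤
    (1 - ∏ w, (1 - (p s(x v, x w) : ℝ))) * reachProb x p R := by
  classical
  rw [erase_eq hv, reachProb, ← bernoulliSum.const_mul]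
  refine bernoulliSum.mono (fun e _ => edgeProb_mem e) fun s _ => ?_
  rw [mul_comm]
  refine mul_le_mul_of_nonneg_right ?_ (by split_ifs <;> simp)
  exact sub_le_sub_left (prod_one_sub_anti (Finset.subset_univ _) _) _

theorem sdiff_le (W : Finset V) : reachProb x p (Finset.univ \ W) ≤
    ∏ v ∈ W, (1 - ∏ w, (1 - (p s(x v, x w) : ℝ))) := by
  induction W using Finset.induction_on with
  | empty => simp [univ_eq]
  | insert a W ha ih =>
    have : Finset.univ \ insert a W = (Finset.univ \ W).erase a := by
      ext b; simp
    rw [this, Finset.prod_insert ha]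
    refine (erase_le (by simpa using ha)).trans ?_
    exact mul_le_mul_of_nonneg_left ih (sub_nonneg.2 (prod_one_sub_le_one _ _))

/-- A vertex that is adjacent to `u ∈ R` with probability `p` can be removed from `R` at a cost
of `p`. -/
theorem erase_ge_edge (hv : v ∈ R) {u : V} (hu : u ∈ R) (huv : u ≠ v) :
    (p s(x v, x u) : ℝ) * reachProb x p R ≤ reachProb x p (R.erase v) := by
  classical
  rw [erase_eq hv, reachProb, ← bernoulliSum.const_mul]
  refine bernoulliSum.mono (fun e _ => edgeProb_mem e) fun s _ => ?_
  rw [mul_comm]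
  refine mul_le_mul_of_nonneg_left ?_ (by split_ifs <;> simp)
  have h1 : ({u} : Finset V) ⊆ avoidingSet R v s :=
    Finset.singleton_subset_iff.2
      (mem_avoidingSet.2 (SimpleGraph.reachesAvoiding_of_mem hu huv))
  have h2 := prod_one_sub_anti (p := p) (x := x) h1 (x v)
  rw [Finset.prod_singleton] at h2
  linarith

open scoped Classical in
/-- The expected number of vertices that are only connected to `R` via `v`, on the event that
all vertices are connected to `R`. -/
noncomputable def cutOffMean (x : V → S) (p : Sym2 S → unitInterval) (R : Finset V) (v : V) : ℝ :=
  bernoulliSum (vertexPairs V) (fun e => (p (e.map x) : ℝ)) fun s =>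
    (if (SimpleGraph.fromEdgeSet (s : Set (Sym2 V))).ReachesSet R then 1 else 0) *
      ((Finset.univ \ avoidingSet R v s).card : ℝ)

/-- Exchangeability: swapping `u` and `v` preserves the types, the set `R` and hence the law of the
graph and the event. -/
theorem cutOffMean_eq {u : V} (hu : u ∈ R) (hv : v ∈ R) (huv : x u = x v) :
    cutOffMean x p R u = cutOffMean x p R v := by
  classical
  set σ := Equiv.swap u v with hσ
  have hR : R.map σ.toEmbedding = R := map_swap_eq hu hv
  have hx : ∀ a, x (σ a) = x a := fun a => by
    rw [hσ, Equiv.swap_apply_def]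
    split_ifs with h1 h2
    · rw [h1, huv]
    · rw [h2, huv]
    · rfl
  have hE : (vertexPairs V).map (Sym2.mapEquiv σ).toEmbedding = vertexPairs V := by
    refine Finset.eq_of_subset_of_card_le (fun e he => ?_) (Finset.card_map _).ge
    obtain ⟨e', he', rfl⟩ := Finset.mem_map.1 he
    induction e' using Sym2.ind with
    | _ a b => exact mem_vertexPairs.2 (σ.injective.ne (mem_vertexPairs.1 he'))
  have hp : ∀ e, (p ((Sym2.mapEquiv σ e).map x) : ℝ) = p (e.map x) := fun e => by
    induction e using Sym2.ind with
    | _ a b =>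
      have : Sym2.map x (Sym2.mapEquiv σ s(a, b)) = s(x (σ a), x (σ b)) := rfl
      rw [this, hx, hx]
      rfl
  rw [cutOffMean, cutOffMean, ← bernoulliSum.comp_map (Sym2.mapEquiv σ) hE hp]
  refine bernoulliSum.congr fun s _ => ?_
  have hs : ((s.map (Sym2.mapEquiv σ).toEmbedding : Finset (Sym2 V)) : Set (Sym2 V))
      = Sym2.map σ '' s := Finset.coe_map _ _
  have hG : SimpleGraph.fromEdgeSet
      ((s.map (Sym2.mapEquiv σ).toEmbedding : Finset (Sym2 V)) : Set (Sym2 V))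
      = (SimpleGraph.fromEdgeSet (s : Set (Sym2 V))).map σ.toEmbedding := by
    rw [hs, SimpleGraph.fromEdgeSet_map]
  have hcard : (Finset.univ \ avoidingSet R u (s.map (Sym2.mapEquiv σ).toEmbedding)).card
      = (Finset.univ \ avoidingSet R v s).card := by
    refine (Finset.card_equiv σ fun a => ?_).symm
    have hav : σ v = u := Equiv.swap_apply_right u v
    have := SimpleGraph.reachesAvoiding_map_iff (G := SimpleGraph.fromEdgeSet (s : Set (Sym2 V)))
      (v := v) (a := a) σ hR
    rw [hav] at this
    simp only [Finset.mem_sdiff, Finset.mem_univ, true_and, mem_avoidingSet, hG, this]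
  simp only [hG, SimpleGraph.reachesSet_map_iff σ hR, hcard]

/-- The cut-off sets of the vertices in `T` have equal means and, when all vertices are connected to
`R`, are disjoint subsets of `V`. -/
theorem card_mul_cutOffMean_le {T : Finset V} (hT : T ⊆ R) (hx : ∀ u ∈ T, x u = x v) (hv : v ∈ R) :
    (T.card : ℝ) * cutOffMean x p R v ≤ Fintype.card V * reachProb x p R := by
  classical
  have h1 : (T.card : ℝ) * cutOffMean x p R v = ∑ u ∈ T, cutOffMean x p R u := by
    rw [Finset.sum_congr rfl fun u hu => cutOffMean_eq (hT hu) hv (hx u hu)]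
    simp
  rw [h1]
  simp only [cutOffMean]
  rw [← bernoulliSum.sum, reachProb, ← bernoulliSum.const_mul]
  refine bernoulliSum.mono (fun e _ => edgeProb_mem e) fun s _ => ?_
  rw [← Finset.mul_sum, mul_comm]
  by_cases hA : (SimpleGraph.fromEdgeSet (s : Set (Sym2 V))).ReachesSet R
  · simp only [hA, if_true, mul_one]
    rw [← Nat.cast_sum, ← Finset.card_biUnion]
    · exact_mod_cast Finset.card_le_univ _
    · intro u hu u' hu' hne
      refine Finset.disjoint_left.2 fun a ha ha' => ?_
      simp only [Finset.mem_sdiff, Finset.mem_univ, true_and, mem_avoidingSet] at ha ha'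
      obtain ⟨u₀, _, h⟩ := hA.exists_reachesAvoiding a
      by_cases h0 : u = u₀
      · exact ha' (h u' (hT hu') fun h' => hne (h0.trans h'.symm))
      · exact ha (h u (hT hu) h0)
  · simp only [hA, if_false]
    simp

/-- A vertex `v` can be removed from `R` nearly at the cost of `1 - ∏ w, (1 - p (x v, x w))` when
`R` has many vertices of the same type as `v`. -/
theorem erase_ge (hv : v ∈ R) {T : Finset V} (hT : T ⊆ R) (hx : ∀ u ∈ T, x u = x v)
    (hT0 : 0 < T.card) {c : ℝ} (hc : ∀ e, (p e : ℝ) ≤ c) :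
    ((1 - ∏ w, (1 - (p s(x v, x w) : ℝ))) - c * Fintype.card V / T.card) * reachProb x p R
      ≤ reachProb x p (R.erase v) := by
  classical
  have hc0 : 0 ≤ c := (p s(x v, x v)).2.1.trans (hc _)
  have hT0' : (0 : ℝ) < T.card := Nat.cast_pos.2 hT0
  have h1 : c * cutOffMean x p R v ≤ c * Fintype.card V / T.card * reachProb x p R := by
    rw [mul_div_assoc, mul_assoc]
    refine mul_le_mul_of_nonneg_left ?_ hc0
    rw [div_mul_eq_mul_div, le_div_iff₀ hT0', mul_comm]
    exact card_mul_cutOffMean_le hT hx hv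
  have h2 : (1 - ∏ w, (1 - (p s(x v, x w) : ℝ))) * reachProb x p R - c * cutOffMean x p R v
      ≤ reachProb x p (R.erase v) := by
    rw [erase_eq hv, reachProb, cutOffMean, ← bernoulliSum.const_mul, ← bernoulliSum.const_mul,
      ← bernoulliSum.sub]
    refine bernoulliSum.mono (fun e _ => edgeProb_mem e) fun s _ => ?_
    -- Union bound for the vertices outside the avoiding set. These include `v` itself, so the loop
    -- factor is absorbed here.
    have h3 : ∏ w ∈ avoidingSet R v s, (1 - (p s(x v, x w) : ℝ))
        ≤ ∏ w, (1 - (p s(x v, x w) : ℝ)) + c * ((Finset.univ \ avoidingSet R v s).card : ℝ) := by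
      have h4 := one_sub_prod_le_sum (p := p) (x := x) (Finset.univ \ avoidingSet R v s) (x v)
      have h5 : ∑ w ∈ Finset.univ \ avoidingSet R v s, (p s(x v, x w) : ℝ)
          ≤ c * ((Finset.univ \ avoidingSet R v s).card : ℝ) := by
        rw [mul_comm, ← nsmul_eq_mul]
        exact Finset.sum_le_card_nsmul _ _ _ fun w _ => hc _
      rw [← Finset.prod_sdiff (Finset.subset_univ (avoidingSet R v s))]
      have h6 := prod_one_sub_nonneg (p := p) (x := x) (avoidingSet R v s) (x v)
      have h7 := prod_one_sub_le_one (p := p) (x := x) (avoidingSet R v s) (x v)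
      nlinarith [prod_one_sub_le_one (p := p) (x := x) (Finset.univ \ avoidingSet R v s) (x v)]
    split_ifs
    · linarith
    · simp
  linarith

end reachProb

/-! ### Product bounds in terms of the type counts -/

theorem IsCompatible.card_filter {S V : Type*} [Fintype V] [DecidableEq S] {x : V → S}
    {k : S → ℕ} (hx : IsCompatible x k) (r : S) : (Finset.univ.filter fun v => x v = r).card = k r := by
  rw [← hx r, Nat.card_eq_fintype_card, Fintype.card_subtype]

theorem IsCompatible.prod_comp {S V : Type*} [Fintype S] [Fintype V] {x : V → S} {k : S → ℕ}
    (hx : IsCompatible x k) (f : S → ℝ) : ∏ v, f (x v) = ∏ s, f s ^ k s := by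
  classical
  rw [← Finset.prod_fiberwise Finset.univ x]
  refine Finset.prod_congr rfl fun s _ => ?_
  rw [Finset.prod_congr rfl fun v hv => by rw [(Finset.mem_filter.1 hv).2], Finset.prod_const,
    hx.card_filter]

namespace reachProb

variable {S V : Type*} [Fintype V] {x : V → S}
  {p : Sym2 S → unitInterval} {k : S → ℕ}

/-- The probability that a vertex of type `r` is adjacent to at least one of `k s` vertices of type
`s`, for `s` in `S`. -/
noncomputable def hitProb [Fintype S] (p : Sym2 S → unitInterval) (k : S → ℕ) (r : S) : ℝ :=
  1 - ∏ s, (1 - (p s(r, s) : ℝ)) ^ k s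

theorem hitProb_eq [Fintype S] (hx : IsCompatible x k) (r : S) :
    1 - ∏ w, (1 - (p s(r, x w) : ℝ)) = hitProb p k r := by
  rw [hitProb, hx.prod_comp fun s => 1 - (p s(r, s) : ℝ)]

theorem hitProb_mem [Fintype S] (r : S) : hitProb p k r ∈ Set.Icc (0 : ℝ) 1 := by
  have h0 : ∀ s, 0 ≤ (1 - (p s(r, s) : ℝ)) ^ k s := fun s => pow_nonneg (one_sub_mem r s).1 _
  refine ⟨sub_nonneg.2 (Finset.prod_le_one (fun s _ => h0 s) fun s _ => ?_),
    sub_le_self _ (Finset.prod_nonneg fun s _ => h0 s)⟩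
  exact pow_le_one₀ (one_sub_mem r s).1 (one_sub_mem r s).2

/-- All vertices but `v₀` are removed. The exponent `k r - 1` allows for `v₀` having type `r`,
whichever type that is; factors of types outside `T` are at most one. -/
theorem singleton_le [Fintype S] [DecidableEq V] (hx : IsCompatible x k) (T : Finset S) (v₀ : V) :
    reachProb x p {v₀} ≤ ∏ r ∈ T, hitProb p k r ^ (k r - 1) := by
  classical
  have h1 := sdiff_le (x := x) (p := p) (Finset.univ.erase v₀)
  have h2 : Finset.univ \ Finset.univ.erase v₀ = {v₀} := by
    ext a; simp
  rw [h2] at h1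
  simp only [hitProb_eq hx] at h1
  refine h1.trans ?_
  have hb := fun r => hitProb_mem (p := p) (k := k) r
  rw [← Finset.prod_fiberwise (Finset.univ.erase v₀) x]
  have h3 : ∀ r, ∏ v ∈ Finset.univ.erase v₀ with x v = r, hitProb p k (x v)
      ≤ hitProb p k r ^ (k r - 1) := by
    intro r
    rw [Finset.prod_congr rfl fun v hv => by rw [(Finset.mem_filter.1 hv).2], Finset.prod_const]
    refine pow_le_pow_of_le_one (hb r).1 (hb r).2 ?_
    rw [← hx.card_filter r, Finset.filter_erase]
    exact Finset.pred_card_le_card_erase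
  have h4 : ∀ r, 0 ≤ ∏ v ∈ Finset.univ.erase v₀ with x v = r, hitProb p k (x v) :=
    fun r => Finset.prod_nonneg fun v _ => (hb _).1
  refine (Finset.prod_le_prod (fun r _ => h4 r) fun r _ => h3 r).trans ?_
  rw [← Finset.prod_sdiff (Finset.subset_univ T)]
  refine mul_le_of_le_one_left (Finset.prod_nonneg fun r _ => pow_nonneg (hb r).1 _) ?_
  exact Finset.prod_le_one (fun r _ => pow_nonneg (hb r).1 _) fun r _ =>
    pow_le_one₀ (hb r).1 (hb r).2

-- While the vertices outside `K` are removed, the remaining set contains `K` and so at least `m`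
-- vertices of the type being removed. The error in `erase_ge` therefore never exceeds `δ`.
open scoped Classical in
theorem prod_le_core [Fintype S] [DecidableEq V] (hx : IsCompatible x k) {T : Finset S} {K : Finset V} {m : ℕ} (hm : 0 < m)
    (hKT : ∀ v, x v ∉ T → v ∈ K) (hKm : ∀ r ∈ T, m ≤ (K.filter fun v => x v = r).card)
    {c δ : ℝ} (hc0 : 0 ≤ c) (hc : ∀ e, (p e : ℝ) ≤ c) (hδ : c * Fintype.card V / m ≤ δ)
    (hδT : ∀ r ∈ T, 0 ≤ hitProb p k r - δ) :
    ∏ r ∈ T, (hitProb p k r - δ) ^ k r ≤ reachProb x p K := by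
  have hm' : (0 : ℝ) < m := Nat.cast_pos.2 hm
  have hδ0 : 0 ≤ δ := le_trans (by positivity) hδ
  have hT : ∀ v, v ∉ K → x v ∈ T := fun v hv => by
    by_contra h
    exact hv (hKT v h)
  have key : ∀ W : Finset V, Disjoint W K →
      ∏ v ∈ W, (hitProb p k (x v) - δ) ≤ reachProb x p (Finset.univ \ W) := by
    intro W
    induction W using Finset.induction_on with
    | empty => simp [univ_eq]
    | insert a W ha ih =>
      intro hdis
      rw [Finset.disjoint_insert_left] at hdis
      have : Finset.univ \ insert a W = (Finset.univ \ W).erase a := by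
        ext b; simp
      rw [this, Finset.prod_insert ha]
      have haT := hT a hdis.1
      have hsub : (K.filter fun v => x v = x a) ⊆ Finset.univ \ W := fun v hv => by
        rw [Finset.mem_sdiff]
        exact ⟨Finset.mem_univ v, fun hvW =>
          Finset.disjoint_left.1 hdis.2 hvW (Finset.mem_filter.1 hv).1⟩
      refine le_trans ?_ (erase_ge (by simpa using ha) hsub
        (fun u hu => (Finset.mem_filter.1 hu).2) (hm.trans_le (hKm _ haT)) hc)
      rw [hitProb_eq hx]
      refine mul_le_mul (sub_le_sub_left (le_trans ?_ hδ) _) (ih hdis.2) ?_ ?_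
      · exact div_le_div_of_nonneg_left (by positivity) hm' (by exact_mod_cast hKm _ haT)
      · exact Finset.prod_nonneg fun v hv =>
          hδT _ (hT v fun hvK => Finset.disjoint_left.1 hdis.2 hv hvK)
      · refine (hδT _ haT).trans (sub_le_sub_left (le_trans ?_ hδ) _)
        exact div_le_div_of_nonneg_left (by positivity) hm' (by exact_mod_cast hKm _ haT)
  have h1 := key (Finset.univ \ K) Finset.sdiff_disjoint
  rw [Finset.sdiff_sdiff_eq_self (Finset.subset_univ K)] at h1
  refine le_trans ?_ h1
  rw [← Finset.prod_fiberwise_of_maps_to (t := T) (g := x)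
    (fun v hv => hT v (Finset.mem_sdiff.1 hv).2)]
  refine Finset.prod_le_prod (fun r hr => pow_nonneg (hδT r hr) _) fun r hr => ?_
  rw [Finset.prod_congr rfl fun v hv => by rw [(Finset.mem_filter.1 hv).2], Finset.prod_const]
  refine pow_le_pow_of_le_one (hδT r hr) (by linarith [(hitProb_mem (p := p) (k := k) r).2]) ?_
  rw [← hx.card_filter r]
  exact Finset.card_le_card (Finset.filter_subset_filter _ (Finset.subset_univ _))

/-- Read upwards from `R`, the set is grown to `K` by vertices that have a potential edge into it;
undoing each such step costs at most a factor `c`. -/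
theorem core_le [DecidableEq V] {K : Finset V} {c : ℝ} (hc : 0 ≤ c)
    (h : ∀ R ⊂ K, R.Nonempty → ∃ v ∈ K \ R, ∃ u ∈ R, c ≤ (p s(x v, x u) : ℝ))
    {R : Finset V} (hR : R ⊆ K) (hne : R.Nonempty) :
    c ^ (K \ R).card * reachProb x p K ≤ reachProb x p R := by
  induction hn : (K \ R).card generalizing R with
  | zero =>
    have : R = K := hR.antisymm (Finset.sdiff_eq_empty_iff_subset.1 (Finset.card_eq_zero.1 hn))
    simp [this]
  | succ n ih =>
    have hRK : R ⊂ K := hR.ssubset_of_ne fun h => by simp [h] at hn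
    obtain ⟨v, hv, u, hu, hvu⟩ := h R hRK hne
    rw [Finset.mem_sdiff] at hv
    have h1 := ih (R := insert v R) (Finset.insert_subset hv.1 hR) (Finset.insert_nonempty _ _) (by
      rw [Finset.sdiff_insert, Finset.card_erase_of_mem (Finset.mem_sdiff.2 hv), hn]
      rfl)
    have h2 := erase_ge_edge (x := x) (p := p) (Finset.mem_insert_self v R)
      (Finset.mem_insert_of_mem hu) (fun h => hv.2 (h ▸ hu))
    rw [Finset.erase_insert hv.2] at h2
    refine le_trans ?_ h2
    rw [pow_succ', mul_assoc]
    exact mul_le_mul hvu h1 (mul_nonneg (pow_nonneg hc _) nonneg) (p _).2.1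

end reachProb

/-! ### Connectedness of the core -/

/-- If vertices of adjacent types are connected by an edge, then connectedness is inherited by every
set of vertices that contains a vertex of each type. -/
theorem exists_rel_of_connected {S V : Type*} {x : V → S} {P : S → S → Prop}
    (hP : ∀ r s, P r s → P s r) {G : SimpleGraph V} (hG : G.Connected)
    (hadj : ∀ a b, G.Adj a b → P (x a) (x b)) {K R : Finset V} (hK : ∀ a, ∃ b ∈ K, x b = x a)
    (hRK : R ⊂ K) (hR : R.Nonempty) : ∃ v ∈ K, v ∉ R ∧ ∃ u ∈ R, P (x v) (x u) := by
  classical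
  obtain ⟨u₀, hu₀⟩ := hR
  obtain ⟨v₀, hv₀, hv₀R⟩ := Finset.exists_of_ssubset hRK
  -- If every type occurs in `R`, the first step of a walk from any `v₀ ∈ K \ R` leads to a type
  -- present in `R`. Otherwise a walk leaves the set of vertices whose type occurs in `R`, and `K`
  -- contains a vertex of the new type.
  by_cases hall : ∀ b, ∃ u ∈ R, x u = x b
  · have hne : v₀ ≠ u₀ := fun h => hv₀R (h ▸ hu₀)
    obtain ⟨p⟩ := hG.preconnected v₀ u₀
    cases p with
    | nil => exact absurd rfl hne
    | @cons _ b _ hab _ =>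
      obtain ⟨u, hu, hub⟩ := hall b
      exact ⟨v₀, hv₀, hv₀R, u, hu, hub ▸ hadj _ _ hab⟩
  · push Not at hall
    obtain ⟨b, hb⟩ := hall
    obtain ⟨p⟩ := hG.preconnected u₀ b
    obtain ⟨d, _, ⟨u, hu, hud⟩, h2⟩ := p.exists_boundary_dart {a | ∃ u ∈ R, x u = x a}
      ⟨u₀, hu₀, rfl⟩ (fun ⟨u, hu, h⟩ => hb u hu h)
    obtain ⟨v, hv, hvd⟩ := hK d.snd
    refine ⟨v, hv, fun hvR => h2 ⟨v, hvR, hvd⟩, u, hu, ?_⟩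
    rw [hud, hvd]
    exact hP _ _ (hadj _ _ d.adj)

/-- Some spanning tree has a nonzero product; that tree is the graph. -/
theorem TypeKernel.exists_connected_of_treeWeight_pos {S V : Type*} [Fintype V] {κ : TypeKernel S}
    {x : V → S} (h : 0 < κ.treeWeight x) :
    ∃ G : SimpleGraph V, G.Connected ∧ ∀ a b, G.Adj a b → 0 < κ.val (x a) (x b) := by
  classical
  rw [treeWeight] at h
  obtain ⟨T, hT, hne⟩ := Finset.exists_ne_zero_of_sum_ne_zero h.ne'
  refine ⟨T, (Finset.mem_filter.1 hT).2.connected, fun a b hab => ?_⟩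
  exact lt_of_le_of_ne (κ.nonneg _ _) fun h0 =>
    Finset.prod_ne_zero_iff.1 hne s(a, b) (SimpleGraph.mem_edgeFinset.2 hab) h0.symm

/-! ### The rate in the extended reals -/

open reachProb

theorem EReal.coe_fintype_sum {ι : Type*} (s : Finset ι) (f : ι → ℝ) :
    ((∑ i ∈ s, f i : ℝ) : EReal) = ∑ i ∈ s, (f i : EReal) := by
  classical
  induction s using Finset.induction_on with
  | empty => simp
  | insert a s ha ih => rw [Finset.sum_insert ha, Finset.sum_insert ha, EReal.coe_add, ih]

/-- Since `q` may vanish, it is compared with a positive `a`, whose logarithm is real. -/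
theorem EReal.coe_mul_log_ofReal_le {t q a : ℝ} (ht : 0 ≤ t) (ha : 0 < a) (h : q ≤ a) :
    (t : EReal) * ENNReal.log (ENNReal.ofReal q) ≤ ((t * Real.log a : ℝ) : EReal) := by
  rw [EReal.coe_mul, ← ENNReal.log_ofReal_of_pos ha]
  exact mul_le_mul_of_nonneg_left (ENNReal.log_le_log (ENNReal.ofReal_le_ofReal h))
    (EReal.coe_nonneg.2 ht)

theorem EReal.le_coe_mul_log_ofReal {t q a : ℝ} (ht : 0 ≤ t) (ha : 0 < a) (h : a ≤ q) :
    ((t * Real.log a : ℝ) : EReal) ≤ (t : EReal) * ENNReal.log (ENNReal.ofReal q) := by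
  rw [EReal.coe_mul, ← ENNReal.log_ofReal_of_pos ha]
  exact mul_le_mul_of_nonneg_left (ENNReal.log_le_log (ENNReal.ofReal_le_ofReal h))
    (EReal.coe_nonneg.2 ht)

namespace TypeKernel

variable {S : Type*}

theorem coe_edgeProb (κ : TypeKernel S) (N : ℕ) (r s : S) :
    (κ.edgeProb N s(r, s) : ℝ) = min 1 (κ.val r s / N) := rfl

variable [Fintype S] {κ : TypeKernel S} {y : S → ℝ}

theorem mulVec_nonneg (hy : ∀ r, 0 ≤ y r) (r : S) : 0 ≤ κ.mulVec y r :=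
  Finset.sum_nonneg fun s _ => mul_nonneg (κ.nonneg r s) (hy s)

theorem connectionRate_eq_bot (hy : ∀ r, 0 ≤ y r) {r : S} (hr : κ.mulVec y r = 0) (hyr : y r ≠ 0) :
    connectionRate κ y = ⊥ := by
  classical
  rw [connectionRate, ← Finset.add_sum_erase _ _ (Finset.mem_univ r), hr]
  simp only [neg_zero, Real.exp_zero, sub_self, ENNReal.ofReal_zero, ENNReal.log_zero]
  rw [EReal.coe_mul_bot_of_pos (lt_of_le_of_ne (hy r) hyr.symm), EReal.bot_add]

theorem one_sub_exp_pos (hy : ∀ r, 0 ≤ y r) {r : S} (hr : κ.mulVec y r ≠ 0) :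
    0 < 1 - Real.exp (-(κ.mulVec y r)) := by
  have := lt_of_le_of_ne (mulVec_nonneg hy r) hr.symm
  rw [sub_pos, Real.exp_lt_one_iff]
  linarith

theorem connectionRate_eq_coe (hy : ∀ r, 0 ≤ y r) (hac : ∀ r, κ.mulVec y r = 0 → y r = 0) :
    connectionRate κ y
      = ((∑ r with y r ≠ 0, y r * Real.log (1 - Real.exp (-(κ.mulVec y r))) : ℝ) : EReal) := by
  rw [connectionRate, Finset.sum_filter, EReal.coe_fintype_sum]
  refine Finset.sum_congr rfl fun r _ => ?_
  by_cases h : y r = 0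
  · simp [h]
  · rw [if_pos h, EReal.coe_mul,
      ENNReal.log_ofReal_of_pos (one_sub_exp_pos hy fun h' => h (hac r h'))]

theorem connectionRate_nonpos (hy : ∀ r, 0 ≤ y r) : connectionRate κ y ≤ 0 := by
  refine Finset.sum_nonpos fun r _ => ?_
  refine mul_nonpos_of_nonneg_of_nonpos (EReal.coe_nonneg.2 (hy r)) ?_
  rw [ENNReal.log_le_zero_iff, ENNReal.ofReal_le_one]
  linarith [Real.exp_pos (-(κ.mulVec y r))]

end TypeKernel

/-! ### Limits as `N → ∞` and the upper bound -/

section Asymptotics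

variable {S : Type*} {κ : TypeKernel S} {κN : ℕ → TypeKernel S} {y : S → ℝ} {k : ℕ → S → ℕ}

theorem tendsto_atTop_of_ne_zero (hy : ∀ r, 0 ≤ y r)
    (hk : ∀ r, Tendsto (fun N : ℕ => (k N r : ℝ) / (N : ℝ)) atTop (𝓝 (y r))) {r : S}
    (hr : y r ≠ 0) : Tendsto (fun N => k N r) atTop atTop := by
  have h := (hk r).pos_mul_atTop (lt_of_le_of_ne (hy r) hr.symm) tendsto_natCast_atTop_atTop
  refine tendsto_natCast_atTop_iff.1 (h.congr' ?_)
  filter_upwards [eventually_gt_atTop 0] with N hN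
  exact div_mul_cancel₀ _ (Nat.cast_ne_zero.2 hN.ne')

theorem tendsto_sub_one_div
    (hk : ∀ r, Tendsto (fun N : ℕ => (k N r : ℝ) / (N : ℝ)) atTop (𝓝 (y r)))
    (hy : ∀ r, 0 ≤ y r) {r : S} (hr : y r ≠ 0) :
    Tendsto (fun N : ℕ => ((k N r - 1 : ℕ) : ℝ) / N) atTop (𝓝 (y r)) := by
  have h1 := (hk r).sub (tendsto_one_div_atTop_nhds_zero_nat (𝕜 := ℝ))
  rw [sub_zero] at h1
  refine h1.congr' ?_
  filter_upwards [(tendsto_atTop_of_ne_zero hy hk hr).eventually_ge_atTop 1] with N hN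
  rw [Nat.cast_sub hN, Nat.cast_one, sub_div]

variable [Fintype S]

theorem tendsto_hitProb
    (hκ : ∀ r s, Tendsto (fun N => (κN N).val r s) atTop (𝓝 (κ.val r s)))
    (hk : ∀ r, Tendsto (fun N : ℕ => (k N r : ℝ) / (N : ℝ)) atTop (𝓝 (y r))) (r : S) :
    Tendsto (fun N => hitProb ((κN N).edgeProb N) (k N) r) atTop
      (𝓝 (1 - Real.exp (-(κ.mulVec y r)))) := by
  have h1 : ∀ s, Tendsto (fun N => (1 - ((κN N).edgeProb N s(r, s) : ℝ)) ^ k N s) atTop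
      (𝓝 (Real.exp (-(κ.val r s * y s)))) := by
    intro s
    have hdiv : Tendsto (fun N : ℕ => (κN N).val r s / N) atTop (𝓝 0) :=
      (hκ r s).div_atTop tendsto_natCast_atTop_atTop
    have hmul : Tendsto (fun N : ℕ => (N : ℝ) * -((κN N).edgeProb N s(r, s) : ℝ)) atTop
        (𝓝 (-κ.val r s)) := by
      refine (hκ r s).neg.congr' ?_
      filter_upwards [hdiv.eventually_le_const one_pos, eventually_gt_atTop 0] with N hN hN0
      rw [TypeKernel.coe_edgeProb, min_eq_right hN]
      have : (N : ℝ) ≠ 0 := Nat.cast_ne_zero.2 hN0.ne'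
      field_simp
    have hpow := Real.tendsto_one_add_pow_exp_of_tendsto hmul
    -- The power `k N s` is split as `N * (k N s / N)`: the `N`-th power converges to an
    -- exponential, the remaining exponent to `y s`.
    have hrpow := hpow.rpow (hk s) (Or.inl (Real.exp_ne_zero _))
    rw [← Real.exp_mul, neg_mul] at hrpow
    refine hrpow.congr' ?_
    filter_upwards [eventually_gt_atTop 0] with N hN0
    have h0 : 0 ≤ 1 + -((κN N).edgeProb N s(r, s) : ℝ) := by
      have := ((κN N).edgeProb N s(r, s)).2.2
      linarith
    rw [← Real.rpow_natCast, ← Real.rpow_mul h0, mul_div_cancel₀ _ (Nat.cast_ne_zero.2 hN0.ne'),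
      Real.rpow_natCast, ← sub_eq_add_neg]
  have h2 := tendsto_finsetProd Finset.univ fun s _ => h1 s
  rw [← Real.exp_sum, Finset.sum_neg_distrib] at h2
  exact h2.const_sub 1

variable {x : (N : ℕ) → Fin (∑ r, k N r) → S}

theorem eventually_nonempty (hy : ∀ r, 0 ≤ y r) (hy0 : y ≠ 0)
    (hk : ∀ r, Tendsto (fun N : ℕ => (k N r : ℝ) / (N : ℝ)) atTop (𝓝 (y r))) :
    ∀ᶠ N in atTop, Nonempty (Fin (∑ r, k N r)) := by
  obtain ⟨r, hr⟩ := Function.ne_iff.1 hy0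
  filter_upwards [(tendsto_atTop_of_ne_zero hy hk hr).eventually_ge_atTop 1] with N hN
  exact ⟨⟨0, (Nat.lt_of_lt_of_le one_pos hN).trans_le
    (Finset.single_le_sum (fun _ _ => Nat.zero_le _) (Finset.mem_univ r))⟩⟩

/-- The upper bound on the connection probability. -/
theorem limsup_connectionProb_le
    (hκ : ∀ r s, Tendsto (fun N => (κN N).val r s) atTop (𝓝 (κ.val r s)))
    (hy : ∀ r, 0 ≤ y r) (hy0 : y ≠ 0)
    (hk : ∀ r, Tendsto (fun N : ℕ => (k N r : ℝ) / (N : ℝ)) atTop (𝓝 (y r)))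
    (hx : ∀ N, IsCompatible (x N) (k N)) :
    limsup (fun N : ℕ => ((1 / (N : ℝ) : ℝ) : EReal) *
      ENNReal.log (connectionProb (κN N) N (x N))) atTop ≤ connectionRate κ y := by
  set α := fun r => 1 - Real.exp (-(κ.mulVec y r)) with hα
  set b := fun N r => hitProb ((κN N).edgeProb N) (k N) r with hb
  have hbα : ∀ r, Tendsto (fun N => b N r) atTop (𝓝 (α r)) := tendsto_hitProb hκ hk
  have hb0 : ∀ N r, 0 ≤ b N r := fun N r => (hitProb_mem r).1
  -- The positive majorant `a` of `b N` is left free: it is `b N` itself when the rate is finite and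
  -- a small constant when the rate is `⊥`.
  have hprob : ∀ᶠ N in atTop, ∀ T : Finset S, ∀ a : S → ℝ, (∀ r ∈ T, 0 < a r) →
      (∀ r ∈ T, b N r ≤ a r) →
      ((1 / (N : ℝ) : ℝ) : EReal) * ENNReal.log (connectionProb (κN N) N (x N)) ≤
        ((∑ r ∈ T, ((k N r - 1 : ℕ) : ℝ) / N * Real.log (a r) : ℝ) : EReal) := by
    filter_upwards [eventually_nonempty hy hy0 hk] with N ⟨v₀⟩ T a ha hba
    rw [connectionProb, singleton_eq v₀]
    have h1 : reachProb (x N) ((κN N).edgeProb N) {v₀} ≤ ∏ r ∈ T, a r ^ (k N r - 1) :=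
      (singleton_le (hx N) T v₀).trans (Finset.prod_le_prod (fun r _ => pow_nonneg (hb0 N r) _)
        fun r hr => pow_le_pow_left₀ (hb0 N r) (hba r hr) _)
    refine (EReal.coe_mul_log_ofReal_le (by positivity)
      (Finset.prod_pos fun r hr => pow_pos (ha r hr) _) h1).trans (EReal.coe_le_coe_iff.2 ?_)
    rw [Real.log_prod fun r hr => (pow_pos (ha r hr) _).ne', Finset.mul_sum]
    refine Finset.sum_le_sum fun r _ => ?_
    rw [Real.log_pow]
    exact le_of_eq (by ring)
  by_cases hac : ∀ r, κ.mulVec y r = 0 → y r = 0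
  · rw [TypeKernel.connectionRate_eq_coe hy hac]
    set T := Finset.univ.filter fun r => y r ≠ 0 with hT
    have hyT : ∀ r ∈ T, y r ≠ 0 := fun r hr => (Finset.mem_filter.1 hr).2
    have hαT : ∀ r ∈ T, 0 < α r := fun r hr =>
      TypeKernel.one_sub_exp_pos hy fun h => hyT r hr (hac r h)
    have hlim : Tendsto (fun N : ℕ => ∑ r ∈ T, ((k N r - 1 : ℕ) : ℝ) / N * Real.log (b N r)) atTop
        (𝓝 (∑ r ∈ T, y r * Real.log (α r))) :=
      tendsto_finsetSum _ fun r hr =>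
        (tendsto_sub_one_div hk hy (hyT r hr)).mul ((hbα r).log (hαT r hr).ne')
    rw [← (EReal.tendsto_coe.2 hlim).limsup_eq]
    refine limsup_le_limsup ?_
    have hpos : ∀ᶠ N in atTop, ∀ r ∈ T, 0 < b N r :=
      (Finset.eventually_all T).2 fun r hr => (hbα r).eventually_const_lt (hαT r hr)
    filter_upwards [hprob, hpos] with N hN hN'
    exact hN T (b N) hN' fun r _ => le_rfl
  · push Not at hac
    obtain ⟨r, hr, hyr⟩ := hac
    rw [TypeKernel.connectionRate_eq_bot hy hr hyr]
    have hα0 : α r = 0 := by simp [hα, hr]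
    have hyr' : 0 < y r := lt_of_le_of_ne (hy r) hyr.symm
    refine le_of_eq ((EReal.eq_bot_iff_forall_lt _).2 fun c => ?_)
    refine lt_of_le_of_lt (limsup_le_of_le (a := ((c - 1 : ℝ) : EReal)) ?_ ?_)
      (EReal.coe_lt_coe_iff.2 (sub_one_lt c))
    · isBoundedDefault
    -- The constant makes the limit `-(|c| + 2)`, which lies below `c - 1`.
    have hlim : Tendsto (fun N : ℕ => ((k N r - 1 : ℕ) : ℝ) / N * -((|c| + 2) / y r)) atTop
        (𝓝 (y r * -((|c| + 2) / y r))) := (tendsto_sub_one_div hk hy hyr).mul_const _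
    have hval : y r * -((|c| + 2) / y r) < c - 1 := by
      rw [mul_neg, mul_div_cancel₀ _ hyr]
      linarith [neg_abs_le c]
    have hbr : ∀ᶠ N in atTop, b N r ≤ Real.exp (-((|c| + 2) / y r)) :=
      (hbα r).eventually_le_const (hα0 ▸ Real.exp_pos _)
    filter_upwards [hprob, hbr, hlim.eventually_le_const hval] with N hN hN' hN''
    refine (hN {r} (fun _ => Real.exp (-((|c| + 2) / y r))) (fun _ _ => Real.exp_pos _)
      fun r' hr' => Finset.mem_singleton.1 hr' ▸ hN').trans (EReal.coe_le_coe_iff.2 ?_)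
    rwa [Finset.sum_singleton, Real.log_exp]

/-! ### The lower bound -/

-- The core consists of `m` vertices of each type in `T` and all vertices of the other types. Its
-- size is bounded in terms of `m` and `B` alone, and it misses no type that occurs.
open scoped Classical in
theorem IsCompatible.exists_core {V : Type*} [Fintype V] {x : V → S} {k : S → ℕ}
    (hx : IsCompatible x k) {T : Finset S} {m : ℕ} (hm : 0 < m) {B : S → ℕ}
    (hkT : ∀ r ∈ T, m ≤ k r) (hkB : ∀ r, r ∉ T → k r ≤ B r) :
    ∃ K : Finset V, (∀ v, x v ∉ T → v ∈ K) ∧ (∀ r ∈ T, m ≤ (K.filter fun v => x v = r).card) ∧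
      K.card ≤ ∑ r, (m + B r) ∧ ∀ a, ∃ b ∈ K, x b = x a := by
  have h : ∀ r, ∃ L ⊆ Finset.univ.filter fun v => x v = r, (r ∈ T → L.card = m) ∧
      (r ∉ T → L = Finset.univ.filter fun v => x v = r) := by
    intro r
    by_cases hr : r ∈ T
    · obtain ⟨L, hL, hcard⟩ := Finset.exists_subset_card_eq ((hkT r hr).trans (hx.card_filter r).ge)
      exact ⟨L, hL, fun _ => hcard, fun h => absurd hr h⟩
    · exact ⟨_, subset_rfl, fun h => absurd h hr, fun _ => rfl⟩
  choose L hL hLT hLT' using h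
  have hLx : ∀ r, ∀ v ∈ L r, x v = r := fun r v hv => (Finset.mem_filter.1 (hL r hv)).2
  refine ⟨Finset.univ.biUnion L, fun v hv => ?_, fun r hr => ?_, ?_, fun a => ?_⟩
  · refine Finset.mem_biUnion.2 ⟨x v, Finset.mem_univ _, ?_⟩
    rw [hLT' _ hv]
    simp
  · rw [← hLT r hr]
    refine Finset.card_le_card fun v hv => Finset.mem_filter.2 ⟨?_, hLx r v hv⟩
    exact Finset.mem_biUnion.2 ⟨r, Finset.mem_univ r, hv⟩
  · refine Finset.card_biUnion_le.trans (Finset.sum_le_sum fun r _ => ?_)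
    by_cases hr : r ∈ T
    · rw [hLT r hr]
      exact Nat.le_add_right _ _
    · rw [hLT' r hr, hx.card_filter]
      exact (hkB r hr).trans (Nat.le_add_left _ _)
  · suffices (L (x a)).Nonempty by
      obtain ⟨b, hb⟩ := this
      exact ⟨b, Finset.mem_biUnion.2 ⟨x a, Finset.mem_univ _, hb⟩, hLx _ b hb⟩
    by_cases hr : x a ∈ T
    · rw [← Finset.card_pos, hLT _ hr]
      exact hm
    · rw [hLT' _ hr]
      exact ⟨a, by simp⟩

/-- A lower bound on the connection probability for fixed `N`. -/
theorem exists_le_reachProb_singleton {V : Type*} [Fintype V] [DecidableEq V] [Nonempty V]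
    {x : V → S} {p : Sym2 S → unitInterval} {k : S → ℕ} (hx : IsCompatible x k) {T : Finset S}
    {m : ℕ} (hm : 0 < m) {B : S → ℕ} (hkT : ∀ r ∈ T, m ≤ k r) (hkB : ∀ r, r ∉ T → k r ≤ B r)
    {c δ c₀ : ℝ} (hc0 : 0 ≤ c) (hc : ∀ e, (p e : ℝ) ≤ c) (hδ : c * Fintype.card V / m ≤ δ)
    (hδT : ∀ r ∈ T, 0 ≤ hitProb p k r - δ) (hc₀ : 0 ≤ c₀) (hc₀1 : c₀ ≤ 1) {G : SimpleGraph V}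
    (hG : G.Connected) (hadj : ∀ a b, G.Adj a b → c₀ ≤ p s(x a, x b)) :
    ∃ v, c₀ ^ (∑ r, (m + B r)) * ∏ r ∈ T, (hitProb p k r - δ) ^ k r ≤ reachProb x p {v} := by
  classical
  obtain ⟨K, hKT, hKm, hKcard, hK⟩ := hx.exists_core hm hkT hkB
  obtain ⟨v, hv, _⟩ := hK (Classical.arbitrary V)
  refine ⟨v, le_trans ?_ (core_le (K := K) hc₀ (fun R hRK hR => ?_)
    (Finset.singleton_subset_iff.2 hv) (Finset.singleton_nonempty v))⟩
  · refine mul_le_mul ?_ (prod_le_core hx hm hKT (fun r hr => by convert hKm r hr) hc0 hc hδ hδT)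
      (Finset.prod_nonneg fun r hr => pow_nonneg (hδT r hr) _) (pow_nonneg hc₀ _)
    exact pow_le_pow_of_le_one hc₀ hc₀1
      ((Finset.card_le_card Finset.sdiff_subset).trans hKcard)
  · obtain ⟨w, hw, hwR, u, hu, hwu⟩ := exists_rel_of_connected
      (P := fun r s => c₀ ≤ (p s(r, s) : ℝ)) (fun r s h => by rwa [Sym2.eq_swap]) hG hadj hK hRK hR
    exact ⟨w, Finset.mem_sdiff.2 ⟨hw, hwR⟩, u, hu, hwu⟩

theorem tendsto_log_div_div (c : ℝ) (hc : 0 < c) :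
    Tendsto (fun N : ℕ => Real.log (c / N) / N) atTop (𝓝 0) := by
  have h1 := (Real.tendsto_pow_log_div_mul_add_atTop 1 0 1 one_ne_zero).comp
    (tendsto_natCast_atTop_atTop (R := ℝ))
  have h2 := (tendsto_const_div_atTop_nhds_zero_nat (Real.log c)).sub h1
  rw [sub_zero] at h2
  refine h2.congr' ?_
  filter_upwards [eventually_gt_atTop 0] with N hN
  rw [Real.log_div hc.ne' (Nat.cast_ne_zero.2 hN.ne'), sub_div]
  simp

/-- The lower bound on the connection probability, up to an error term that vanishes as
`m → ∞`. -/
theorem le_liminf_connectionProb_aux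
    (hκ : ∀ r s, Tendsto (fun N => (κN N).val r s) atTop (𝓝 (κ.val r s)))
    (hy : ∀ r, 0 ≤ y r) (hy0 : y ≠ 0)
    (hk : ∀ r, Tendsto (fun N : ℕ => (k N r : ℝ) / (N : ℝ)) atTop (𝓝 (y r)))
    (hx : ∀ N, IsCompatible (x N) (k N)) (htree : ∀ᶠ N in atTop, 0 < κ.treeWeight (x N))
    (hbdd : ∀ r, y r = 0 → BddAbove (Set.range fun N => k N r)) {C D : ℝ} (hC : 0 ≤ C)
    (hCκ : ∀ᶠ N in atTop, ∀ r s, (κN N).val r s ≤ C)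
    (hD : ∀ᶠ N : ℕ in atTop, ((∑ r, k N r : ℕ) : ℝ) / N ≤ D)
    {m : ℕ} (hm : 0 < m)
    (hα : ∀ r, y r ≠ 0 → C * D / m < 1 - Real.exp (-(κ.mulVec y r))) :
    ((∑ r with y r ≠ 0, y r * Real.log (1 - Real.exp (-(κ.mulVec y r)) - C * D / m) : ℝ) : EReal)
      ≤ liminf (fun N : ℕ => ((1 / (N : ℝ) : ℝ) : EReal) *
        ENNReal.log (connectionProb (κN N) N (x N))) atTop := by
  -- Edge probabilities are at most `C / N` and there are at most `D * N` vertices, so this bounds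
  -- the loss per removed vertex.
  set δ := C * D / m with hδ
  set T := Finset.univ.filter fun r => y r ≠ 0 with hT
  have hyT : ∀ r ∈ T, y r ≠ 0 := fun r hr => (Finset.mem_filter.1 hr).2
  have hbα := tendsto_hitProb hκ hk
  have hB : ∀ r, ∃ B : ℕ, r ∉ T → ∀ N, k N r ≤ B := fun r => by
    by_cases hr : y r = 0
    · obtain ⟨B, hB⟩ := hbdd r hr
      exact ⟨B, fun _ N => hB ⟨N, rfl⟩⟩
    · exact ⟨0, fun h => absurd (by simp [hT, hr]) h⟩
  choose B hB using hB
  -- Strictly below every positive value of `κ`, so that `c₀` is eventually also a lower bound for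
  -- the corresponding values of `κN N`.
  obtain ⟨c₀, hc₀κ, hc₀⟩ : ∃ c₀ : ℝ, (∀ r s, 0 < κ.val r s → c₀ < κ.val r s) ∧ 0 < c₀ := by
    have h1 : ∀ᶠ c₀ : ℝ in 𝓝[>] 0, ∀ r s, 0 < κ.val r s → c₀ < κ.val r s := by
      refine eventually_all.2 fun r => eventually_all.2 fun s => ?_
      by_cases h : 0 < κ.val r s
      · filter_upwards [nhdsWithin_le_nhds (Iio_mem_nhds h)] with c₀ hc₀ _ using hc₀
      · exact Eventually.of_forall fun _ h' => absurd h' h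
    exact (h1.and self_mem_nhdsWithin).exists
  have hκ₀ : ∀ᶠ N in atTop, ∀ r s, 0 < κ.val r s → c₀ ≤ (κN N).val r s := by
    refine eventually_all.2 fun r => eventually_all.2 fun s => ?_
    by_cases h : 0 < κ.val r s
    · filter_upwards [(hκ r s).eventually_const_le (hc₀κ r s h)] with N hN _ using hN
    · exact Eventually.of_forall fun _ h' => absurd h' h
  -- The first term is the cost of dismantling the core, which vanishes because its size is bounded;
  -- the second is the cost of reaching the core.
  have hlim : Tendsto (fun N : ℕ => ((∑ r, (m + B r) : ℕ) : ℝ) * (Real.log (c₀ / N) / N) +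
      ∑ r ∈ T, (k N r : ℝ) / N * Real.log (hitProb ((κN N).edgeProb N) (k N) r - δ)) atTop
      (𝓝 (((∑ r, (m + B r) : ℕ) : ℝ) * 0 +
        ∑ r ∈ T, y r * Real.log (1 - Real.exp (-(κ.mulVec y r)) - δ))) := by
    refine ((tendsto_log_div_div c₀ hc₀).const_mul _).add (tendsto_finsetSum _ fun r hr => ?_)
    exact (hk r).mul (((hbα r).sub_const δ).log (sub_pos.2 (hα r (hyT r hr))).ne')
  rw [mul_zero, zero_add] at hlim
  rw [← (EReal.tendsto_coe.2 hlim).liminf_eq]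
  refine liminf_le_liminf ?_
  have hpos : ∀ᶠ N in atTop, ∀ r ∈ T, 0 < hitProb ((κN N).edgeProb N) (k N) r - δ :=
    (Finset.eventually_all T).2 fun r hr =>
      ((hbα r).sub_const δ).eventually_const_lt (sub_pos.2 (hα r (hyT r hr)))
  have hkm : ∀ᶠ N in atTop, ∀ r ∈ T, m ≤ k N r :=
    (Finset.eventually_all T).2 fun r hr =>
      (tendsto_atTop_of_ne_zero hy hk (hyT r hr)).eventually_ge_atTop m
  filter_upwards [hpos, hkm, hκ₀, hCκ, hD, htree, eventually_nonempty hy hy0 hk,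
    eventually_gt_atTop 0, tendsto_natCast_atTop_atTop.eventually_ge_atTop c₀]
    with N hpos hkm hκ₀ hCκ hD htree hne hN hNc₀
  have hN' : (0 : ℝ) < N := Nat.cast_pos.2 hN
  obtain ⟨G, hG, hadj⟩ := TypeKernel.exists_connected_of_treeWeight_pos htree
  have hc₀N : c₀ / N ≤ 1 := (div_le_one hN').2 hNc₀
  have hc : ∀ e, ((κN N).edgeProb N e : ℝ) ≤ C / N := fun e => by
    induction e using Sym2.ind with
    | _ r s =>
      rw [TypeKernel.coe_edgeProb]
      exact (min_le_right _ _).trans (div_le_div_of_nonneg_right (hCκ r s) hN'.le)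
  have hcδ : C / N * Fintype.card (Fin (∑ r, k N r)) / m ≤ δ := by
    rw [Fintype.card_fin, hδ, div_mul_eq_mul_div, mul_div_assoc]
    gcongr
  have hc₀adj : ∀ a b, G.Adj a b → c₀ / N ≤ (κN N).edgeProb N s(x N a, x N b) := fun a b hab => by
    rw [TypeKernel.coe_edgeProb]
    exact le_min hc₀N (div_le_div_of_nonneg_right (hκ₀ _ _ (hadj a b hab)) hN'.le)
  obtain ⟨v, hv⟩ := exists_le_reachProb_singleton (hx N) hm hkm (fun r hr => hB r hr N)
    (by positivity) hc hcδ (fun r hr => (hpos r hr).le) (by positivity) hc₀N hG hc₀adj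
  rw [connectionProb, singleton_eq v]
  have hprod : 0 < ∏ r ∈ T, (hitProb ((κN N).edgeProb N) (k N) r - δ) ^ k N r :=
    Finset.prod_pos fun r hr => pow_pos (hpos r hr) _
  have hpow : 0 < (c₀ / N) ^ (∑ r, (m + B r)) := pow_pos (div_pos hc₀ hN') _
  refine le_trans (EReal.coe_le_coe_iff.2 (le_of_eq ?_))
    (EReal.le_coe_mul_log_ofReal (by positivity) (mul_pos hpow hprod) hv)
  rw [Real.log_mul hpow.ne' hprod.ne', Real.log_pow,
    Real.log_prod fun r hr => (pow_pos (hpos r hr) _).ne', mul_add, Finset.mul_sum]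
  congr 1
  · ring
  · refine Finset.sum_congr rfl fun r _ => ?_
    rw [Real.log_pow]
    ring

/-- The lower bound on the connection probability. -/
theorem le_liminf_connectionProb
    (hκ : ∀ r s, Tendsto (fun N => (κN N).val r s) atTop (𝓝 (κ.val r s)))
    (hy : ∀ r, 0 ≤ y r) (hy0 : y ≠ 0)
    (hk : ∀ r, Tendsto (fun N : ℕ => (k N r : ℝ) / (N : ℝ)) atTop (𝓝 (y r)))
    (hx : ∀ N, IsCompatible (x N) (k N)) (htree : ∀ᶠ N in atTop, 0 < κ.treeWeight (x N))
    (hbdd : ∀ r, y r = 0 → BddAbove (Set.range fun N => k N r)) :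
    connectionRate κ y ≤ liminf (fun N : ℕ => ((1 / (N : ℝ) : ℝ) : EReal) *
      ENNReal.log (connectionProb (κN N) N (x N))) atTop := by
  by_cases hac : ∀ r, κ.mulVec y r = 0 → y r = 0
  · rw [TypeKernel.connectionRate_eq_coe hy hac]
    have hα : ∀ r, y r ≠ 0 → 0 < 1 - Real.exp (-(κ.mulVec y r)) := fun r hr =>
      TypeKernel.one_sub_exp_pos hy fun h => hr (hac r h)
    set C := ∑ r, ∑ s, κ.val r s + 1 with hCdef
    set D := ∑ r, y r + 1 with hDdef
    have hC : 0 ≤ C := add_nonneg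
      (Finset.sum_nonneg fun r _ => Finset.sum_nonneg fun s _ => κ.nonneg r s) zero_le_one
    have hCκ : ∀ᶠ N in atTop, ∀ r s, (κN N).val r s ≤ C := by
      refine eventually_all.2 fun r => eventually_all.2 fun s =>
        (hκ r s).eventually_le_const (lt_of_le_of_lt ?_ (lt_add_one _))
      refine (Finset.single_le_sum (f := fun s => κ.val r s) (fun s _ => κ.nonneg r s)
        (Finset.mem_univ s)).trans ?_
      exact Finset.single_le_sum (f := fun r => ∑ s, κ.val r s)
        (fun r _ => Finset.sum_nonneg fun s _ => κ.nonneg r s) (Finset.mem_univ r)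
    have hD : ∀ᶠ N : ℕ in atTop, ((∑ r, k N r : ℕ) : ℝ) / N ≤ D := by
      have h := tendsto_finsetSum Finset.univ fun r _ => hk r
      filter_upwards [h.eventually_le_const (lt_add_one _)] with N hN
      rwa [Nat.cast_sum, Finset.sum_div]
    have hδ : Tendsto (fun m : ℕ => C * D / m) atTop (𝓝 0) :=
      tendsto_const_div_atTop_nhds_zero_nat _
    have hlim : Tendsto (fun m : ℕ => ∑ r with y r ≠ 0,
        y r * Real.log (1 - Real.exp (-(κ.mulVec y r)) - C * D / m)) atTop
        (𝓝 (∑ r with y r ≠ 0, y r * Real.log (1 - Real.exp (-(κ.mulVec y r))))) := by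
      refine tendsto_finsetSum _ fun r hr => Tendsto.const_mul _ ?_
      have := (hδ.const_sub (1 - Real.exp (-(κ.mulVec y r))))
      rw [sub_zero] at this
      exact this.log (hα r (Finset.mem_filter.1 hr).2).ne'
    -- The limit `m → ∞` is taken after `N → ∞`.
    refine le_of_tendsto (EReal.tendsto_coe.2 hlim) ?_
    have hev : ∀ᶠ m : ℕ in atTop, ∀ r, y r ≠ 0 →
        C * D / m < 1 - Real.exp (-(κ.mulVec y r)) := by
      refine eventually_all.2 fun r => ?_
      by_cases hr : y r = 0
      · exact Eventually.of_forall fun _ h => absurd hr h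
      · filter_upwards [hδ.eventually_lt_const (hα r hr)] with m hm _ using hm
    filter_upwards [hev, eventually_gt_atTop 0] with m hm hm0
    exact le_liminf_connectionProb_aux hκ hy hy0 hk hx htree hbdd hC hCκ hD hm0 hm
  · push Not at hac
    obtain ⟨r, hr, hyr⟩ := hac
    rw [TypeKernel.connectionRate_eq_bot hy hr hyr]
    exact bot_le

end Asymptotics

/-! ### The theorem -/

theorem theorem3p6 {S : Type*} [Fintype S]
    (κ : TypeKernel S) (κN : ℕ → TypeKernel S)
    (hκ : ∀ r s, Tendsto (fun N => (κN N).val r s) atTop (𝓝 (κ.val r s)))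
    (y : S → ℝ) (hy : ∀ r, y r ∈ Set.Icc (0 : ℝ) 1) (hy0 : y ≠ 0)
    (k : ℕ → S → ℕ)
    (hk : ∀ r, Tendsto (fun N : ℕ => (k N r : ℝ) / (N : ℝ)) atTop (𝓝 (y r)))
    (x : (N : ℕ) → Fin (∑ r, k N r) → S) (hx : ∀ N, IsCompatible (x N) (k N)) :
    -- the value of the right-hand side if `y` is not absolutely continuous w.r.t. `κ y`
    ((¬ ∀ r, κ.mulVec y r = 0 → y r = 0) → connectionRate κ y = ⊥) ∧
    -- the upper bound
    limsup (fun N : ℕ => ((1 / (N : ℝ) : ℝ) : EReal) *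
      ENNReal.log (connectionProb (κN N) N (x N))) atTop ≤ connectionRate κ y ∧
    -- the limit
    ((∀ᶠ N in atTop, 0 < κ.treeWeight (x N)) →
      (∀ r, y r = 0 → BddAbove (Set.range fun N => k N r)) →
      Tendsto (fun N : ℕ => ((1 / (N : ℝ) : ℝ) : EReal) *
        ENNReal.log (connectionProb (κN N) N (x N))) atTop (𝓝 (connectionRate κ y)) ∧
      connectionRate κ y ≤ 0) := by
  have hy' : ∀ r, 0 ≤ y r := fun r => (hy r).1
  have hub := limsup_connectionProb_le hκ hy' hy0 hk hx
  refine ⟨fun h => ?_, hub, fun htree hbdd => ⟨?_, TypeKernel.connectionRate_nonpos hy'⟩⟩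
  · push Not at h
    obtain ⟨r, hr, hyr⟩ := h
    exact TypeKernel.connectionRate_eq_bot hy' hr hyr
  · exact tendsto_of_le_liminf_of_limsup_le
      (le_liminf_connectionProb hκ hy' hy0 hk hx htree hbdd) hub
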